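/- Let $A\ge 1$ be an integer, let $b=-A+i$ or $b=-A-i$, and let $J\subseteq\{0,1,\ldots,A^2\}$ be a set of digits with at least two elements. Let \[ \mathcal K_{J}=\Big\{\sum_{j=1}^{\infty} d_j b^{-j} : d_j\in J \text{ for all } j\ge 1\Big\}\subset\mathbb C . \] For a real function $\Psi$ let $\mathcal K(\Psi)$ be the set of all $\zeta\in\mathbb C$ such that $|\zeta-p/q|<\Psi(|q|)$ for infinitely many Gaussian rationals $p/q\in\mathbb Q(i)$ (with $p,q\in\mathbb Z[i]$, $q\neq 0$). Let $\Psi$ be positive on $(1,\infty)$ and such that $x\mapsto x^2\Psi(x)$ is non-increasing on $(1,\infty)$ and $x^2\Psi(x)\to 0$ as $x\to\infty$. Then, for every real number $c$ with $0<c<|b|^{-1}$, the set \[ \big(\mathcal K(\Psi)\setminus\mathcal K(c\Psi)\big)\cap\mathcal K_{J} \] is non-empty. Moreover, if $A\ge 2$, this set is uncountable. -/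

import Mathlib

open Filter Topology

/-- The set of `Ψ`-approximable complex numbers: those `ζ` such that `|ζ - p/q| < Ψ(|q|)` holds for
infinitely many Gaussian rationals `p/q` (with `p, q` Gaussian integers, `q ≠ 0`). What is
counted are the numbers `p/q`, not the pairs `(p, q)`. -/
def approximableSet (Ψ : ℝ → ℝ) : Set ℂ :=
  {ζ : ℂ | {r : ℂ | ∃ p q : GaussianInt, q ≠ 0 ∧ r = (p : ℂ) / (q : ℂ) ∧
    ‖ζ - r‖ < Ψ ‖(q : ℂ)‖}.Infinite}

/-- The set of complex numbers `∑_{j ≥ 1} d_j b^{-j}` with all digits `d_j` in `J`. The digit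
`d_{j+1}` of the expansion is `d j` here. -/
def digitSet (b : ℂ) (J : Set ℕ) : Set ℂ :=
  {ζ : ℂ | ∃ d : ℕ → ℕ, (∀ j, d j ∈ J) ∧ HasSum (fun j : ℕ => (d j : ℂ) * (b ^ (j + 1))⁻¹) ζ}

/-!
Fix two digits `x ≠ y` of `J`, put `d = y - x`, and write `b` as a Gaussian integer `β`. All points
constructed have the digit `y` at sparse positions `n 0 < n 1 < ⋯` with `2 * n k ≤ n (k + 1)`, and
the digit `x` elsewhere, so that they are `x / (β - 1) + d θ` with `θ = ∑ β ^ (-n k)`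
(`foldPoint_mem_digitSet`).

**Folding.** The partial sums of `θ` are related by `θ_{k+1} = θ_k + 1 / (t Q²)` with `Q = β ^ n k`
and `t = β ^ (n (k + 1) - 2 * n k)`, as in the folding lemma for continued fractions. For a fraction
`p / q` put `Δ_k = p β ^ n k - q N_k`, where `θ_k = N_k / β ^ n k`; then
`|q|² |θ_k - p / q| = |q| |Δ_k| / |β ^ n k|`. Passing from `k` to `k + 1`, the pairs `(q, Δ_k)` are
transformed in a way that is symmetric in the two coordinates up to sign, and this replaces the
theory of continued fractions. The outcome (`foldSum_lower_bound`) is that `θ` is badly approximable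
if the jumps `n (k + 1) - 2 * n k` are bounded, with a constant that depends only on the bound; and
one exceptional jump at the index `j` affects only fractions with `β ^ n j ∣ q`. For the points
`foldPoint` the same holds with `β ^ n j ∣ q (β - 1) d`.

**Exact order.** A point with bounded jumps is called a stage if it strictly avoids `c Ψ`. Given a
stage, take `j` large and let the jump at `j` be `m`, keeping the later differences of exponents
fixed. With `r` the partial sum up to `j`, the points `z m` satisfy
`z (m + 1) - r = β⁻¹ (z m - r)`. If `m` is too large then `r` itself is a better approximation than
`c Ψ` allows, while for an `m` smaller by a bounded amount the point is still a stage, by the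
folding bound. So some `z m` is a stage and `z (m + 1)` is not. The fraction `p / q` responsible for
this satisfies `β ^ n j ∣ q (β - 1) d`, hence `(β - 1) q r` is a Gaussian integer, and therefore the
fraction `r + β (p / q - r)` has the same denominator `q`. Its distance to `z m` is
`|β| |z (m + 1) - p / q| ≤ |β| c Ψ(|q|) < Ψ(|q|)`. This exactness is why every `c < 1 / |b|` is
admissible, whatever the digits and the common factors of numerators and denominators
(`IsStage.exists_next`).

**Conclusion.** The new stage is arbitrarily close to the old one and different from it. Points of
the closure of the stages still satisfy the non-strict inequalities and lie in the digit set, which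
is closed, and by Baire's theorem some point of the closure has infinitely many approximations
better than `Ψ` and is outside any given sequence (`exists_mem_ne_seq`). Thus the set is uncountable,
for `A = 1` as well.
-/

/-! ### Gaussian integers in the complex plane -/

theorem GaussianInt.one_le_norm_toComplex {z : GaussianInt} (hz : z ≠ 0) : 1 ≤ ‖(z : ℂ)‖ := by
  have h1 : (0 : ℤ) < Zsqrtd.norm z := GaussianInt.norm_pos.2 hz
  have h2 : (1 : ℝ) ≤ ((Zsqrtd.norm z : ℤ) : ℝ) := by exact_mod_cast h1
  rw [GaussianInt.intCast_real_norm, Complex.normSq_eq_norm_sq] at h2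
  nlinarith [_root_.norm_nonneg (z : ℂ)]

theorem GaussianInt.two_le_sq_norm_toComplex {z : GaussianInt} (hz : 1 < ‖(z : ℂ)‖) :
    2 ≤ ‖(z : ℂ)‖ ^ 2 := by
  have h1 : ((Zsqrtd.norm z : ℤ) : ℝ) = ‖(z : ℂ)‖ ^ 2 := by
    rw [GaussianInt.intCast_real_norm, Complex.normSq_eq_norm_sq]
  have h2 : (1 : ℝ) < ((Zsqrtd.norm z : ℤ) : ℝ) := by rw [h1]; nlinarith
  have h3 : (1 : ℤ) < Zsqrtd.norm z := by exact_mod_cast h2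
  have h4 : (2 : ℤ) ≤ Zsqrtd.norm z := h3
  rw [← h1]; exact_mod_cast h4

theorem GaussianInt.finite_norm_le (R : ℝ) : {z : GaussianInt | ‖(z : ℂ)‖ ≤ R}.Finite := by
  have hf : ((Set.Icc (-⌈R⌉) ⌈R⌉) ×ˢ (Set.Icc (-⌈R⌉) ⌈R⌉) : Set (ℤ × ℤ)).Finite :=
    (Set.finite_Icc _ _).prod (Set.finite_Icc _ _)
  refine (hf.preimage (f := fun z : GaussianInt => (z.re, z.im)) ?_).subset ?_
  · intro x _ y _ h
    exact Zsqrtd.ext (congrArg Prod.fst h) (congrArg Prod.snd h)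
  · intro z hz
    have hz' : ‖(z : ℂ)‖ ≤ R := hz
    have h1 := (Complex.abs_re_le_norm (z : ℂ)).trans hz'
    have h2 := (Complex.abs_im_le_norm (z : ℂ)).trans hz'
    rw [← GaussianInt.intCast_re] at h1
    rw [← GaussianInt.intCast_im] at h2
    have h3 : |z.re| ≤ ⌈R⌉ := by
      have : ((|z.re| : ℤ) : ℝ) ≤ (⌈R⌉ : ℝ) := by push_cast; exact h1.trans (Int.le_ceil R)
      exact_mod_cast this
    have h4 : |z.im| ≤ ⌈R⌉ := by
      have : ((|z.im| : ℤ) : ℝ) ≤ (⌈R⌉ : ℝ) := by push_cast; exact h2.trans (Int.le_ceil R)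
      exact_mod_cast this
    exact ⟨abs_le.1 h3, abs_le.1 h4⟩

theorem ne_zero_of_one_lt_norm {β : GaussianInt} (hβ : 1 < ‖(β : ℂ)‖) : β ≠ 0 := by
  rintro rfl; simp at hβ; linarith

theorem sub_one_ne_zero_of_one_lt_norm {β : GaussianInt} (hβ : 1 < ‖(β : ℂ)‖) :
    (β : ℂ) - 1 ≠ 0 := by
  intro h; rw [sub_eq_zero] at h; rw [h] at hβ; simp at hβ

theorem gaussian_sub_one_ne_zero_of_one_lt_norm {β : GaussianInt} (hβ : 1 < ‖(β : ℂ)‖) :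
    β - 1 ≠ 0 := by
  intro h; rw [sub_eq_zero] at h; rw [h] at hβ; simp at hβ

/-! ### Lacunary sums and the folding induction -/

/-- Numerators of the partial sums: `foldNum β n k / β ^ n k = ∑_{i ≤ k} β ^ (-n i)`. -/
def foldNum (β : GaussianInt) (n : ℕ → ℕ) : ℕ → GaussianInt
  | 0 => 1
  | k + 1 => β ^ (n (k + 1) - n k) * foldNum β n k + 1

/-- The lacunary sum `∑_k β ^ (-n k)`. -/
noncomputable def foldSum (β : GaussianInt) (n : ℕ → ℕ) : ℂ := ∑' k, ((β : ℂ) ^ n k)⁻¹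

section Fold

variable {β : GaussianInt} {n : ℕ → ℕ}

/-- The start `n 0 = 8` makes `|β| ^ n 0` at least `16`, which is large enough for the errors in
`fold_induction` to be summable from the first step on. -/
theorem eight_mul_two_pow_le (h0 : n 0 = 8) (h2 : ∀ k, 2 * n k ≤ n (k + 1)) (k : ℕ) :
    8 * 2 ^ k ≤ n k := by
  induction k with
  | zero => simp [h0]
  | succ k ih => have := h2 k; rw [pow_succ]; omega

theorem strictMono_of_two_mul_le (h0 : n 0 = 8) (h2 : ∀ k, 2 * n k ≤ n (k + 1)) :
    StrictMono n := by
  refine strictMono_nat_of_lt_succ fun k => ?_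
  have := eight_mul_two_pow_le h0 h2 k
  have := h2 k
  have : 0 < 2 ^ k := by positivity
  omega

theorem isCoprime_foldNum (h : StrictMono n) (k : ℕ) :
    IsCoprime (β ^ n k) (foldNum β n k) := by
  apply IsCoprime.pow_left
  cases k with
  | zero => exact isCoprime_one_right
  | succ k =>
    have hk : n k < n (k + 1) := h (Nat.lt_succ_self k)
    obtain ⟨e, he⟩ : ∃ e, n (k + 1) - n k = e + 1 := ⟨n (k + 1) - n k - 1, by omega⟩
    refine ⟨-(β ^ e * foldNum β n k), 1, ?_⟩
    rw [foldNum, he, pow_succ]; ring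

theorem foldNum_div (hβ : β ≠ 0) (h : Monotone n) (k : ℕ) :
    (foldNum β n k : ℂ) / (β : ℂ) ^ n k = ∑ i ∈ Finset.range (k + 1), ((β : ℂ) ^ n i)⁻¹ := by
  have hb : (β : ℂ) ≠ 0 := by simpa using hβ
  induction k with
  | zero => simp [foldNum]
  | succ k ih =>
    rw [Finset.sum_range_succ, ← ih, foldNum]
    have hk : n k ≤ n (k + 1) := h (Nat.le_succ k)
    have e : (β : ℂ) ^ n (k + 1) = (β : ℂ) ^ (n (k + 1) - n k) * (β : ℂ) ^ n k := by
      rw [← pow_add]; congr 1; omega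
    rw [map_add, map_mul, map_pow, map_one, e]
    field_simp

theorem norm_inv_pow_le (hβ : 1 < ‖(β : ℂ)‖) (h : StrictMono n) (j k : ℕ) :
    ‖((β : ℂ) ^ n (k + j))⁻¹‖ ≤ (‖(β : ℂ)‖ ^ n j)⁻¹ * (‖(β : ℂ)‖⁻¹) ^ k := by
  rw [norm_inv, norm_pow, inv_pow, ← mul_inv, ← pow_add]
  have : n j + k ≤ n (k + j) := by rw [add_comm, add_comm k]; simpa [add_comm] using h.add_le_nat k j
  gcongr
  exact hβ.le

theorem summable_foldSum (hβ : 1 < ‖(β : ℂ)‖) (h : StrictMono n) :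
    Summable fun k => ((β : ℂ) ^ n k)⁻¹ := by
  refine Summable.of_norm_bounded (g := fun k => (‖(β : ℂ)‖ ^ n 0)⁻¹ * (‖(β : ℂ)‖⁻¹) ^ k) ?_
    fun k => by simpa using norm_inv_pow_le hβ h 0 k
  exact (summable_geometric_of_lt_one (by positivity) (inv_lt_one_of_one_lt₀ hβ)).mul_left _

/-- The tail of the lacunary sum from the index `j` on is dominated by a geometric series. -/
theorem norm_tsum_tail_le (hβ : 1 < ‖(β : ℂ)‖) (h : StrictMono n) (j : ℕ) :
    ‖∑' k, ((β : ℂ) ^ n (k + j))⁻¹‖ ≤ (‖(β : ℂ)‖ ^ n j)⁻¹ * (1 - ‖(β : ℂ)‖⁻¹)⁻¹ := by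
  have hs := (hasSum_geometric_of_lt_one (r := ‖(β : ℂ)‖⁻¹) (by positivity)
    (inv_lt_one_of_one_lt₀ hβ)).mul_left (‖(β : ℂ)‖ ^ n j)⁻¹
  exact tsum_of_norm_bounded hs fun k => norm_inv_pow_le hβ h j k

/-- The analytic core of the folding step. Here `u = |q|`, `v = |Δ|`, `w = |XΔ - q|`, and the
factor `1 + 1 / min u v` absorbs the one step in which the relative error `u / (X v)` fails to be
small compared with `1 / X`: in that step the smaller coordinate at least doubles. -/
theorem fold_step_ineq {u v w X E δ l l' : ℝ} (hu : 1 ≤ u) (hv : 1 ≤ v) (huw : u ≤ w)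
    (h1 : X * v ≤ w + u) (hE : 1 ≤ E) (hEX : E ≤ X) (hδ : 0 < δ) (hδ' : δ ≤ 1 / 64)
    (hl' : 1 ≤ l') (hll : l' ≤ l) (hl2 : l' ≤ 2) (hlX : l' ≤ l * (1 - 2 / X))
    (h : E * δ * l * (1 + 1 / min u v) ≤ u * v) :
    X * E * δ * l' * (1 + 1 / min u w) ≤ u * w := by
  have hX : 1 ≤ X := hE.trans hEX
  rw [min_eq_left huw]
  have hu1 : 1 / u ≤ 1 := by rw [div_le_one (by linarith)]; exact hu
  have hu0 : 0 < 1 / u := by positivity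
  by_cases hbig : 4 * δ * (X * E) ≤ u * w
  · refine le_trans ?_ hbig
    have : l' * (1 + 1 / u) ≤ 4 := by nlinarith
    have h3 : 0 < X * E * δ := by positivity
    nlinarith
  push Not at hbig
  have hXE : 0 < X * E := by positivity
  -- the approximation is already good one level below
  have huv : u * v ≤ E / 8 := by
    have : X * (u * v) ≤ X * (E / 8) := by
      have : X * (u * v) ≤ 2 * (u * w) := by nlinarith
      nlinarith
    exact le_of_mul_le_mul_left this (by linarith)
  have hlow : u * v * X * (1 - u / (X * v)) ≤ u * w := by
    have : u * v * X * (1 - u / (X * v)) = u * (X * v - u) := by field_simp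
    rw [this]; nlinarith
  refine le_trans ?_ hlow
  have hl0 : 0 < l := by linarith
  rcases le_or_gt u (2 * v) with hc | hc
  · have e1 : u / (X * v) ≤ 2 / X := by
      rw [div_le_div_iff₀ (by positivity) (by positivity)]; nlinarith
    have e2 : 1 + 1 / u ≤ 1 + 1 / min u v := by
      have : 0 < min u v := lt_min (by linarith) (by linarith)
      gcongr; exact min_le_left _ _
    have h0X : 0 ≤ 1 - 2 / X := by
      by_contra hneg
      push Not at hneg
      nlinarith
    calc X * E * δ * l' * (1 + 1 / u) ≤ X * E * δ * (l * (1 - 2 / X)) * (1 + 1 / u) := by gcongr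
      _ = E * δ * l * (1 + 1 / u) * X * (1 - 2 / X) := by ring
      _ ≤ E * δ * l * (1 + 1 / min u v) * X * (1 - 2 / X) := by gcongr
      _ ≤ u * v * X * (1 - 2 / X) := by gcongr
      _ ≤ u * v * X * (1 - u / (X * v)) := by gcongr
  · rw [min_eq_right (by linarith)] at h
    have e1 : u / (X * v) ≤ 1 / (8 * v ^ 2) := by
      rw [div_le_div_iff₀ (by positivity) (by positivity)]; nlinarith
    have e2 : 1 / u ≤ 1 / (2 * v) := by gcongr
    have hv0 : 0 < 1 / v := by positivity
    have hv1 : 1 / v ≤ 1 := by rw [div_le_one (by linarith)]; exact hv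
    have e3 : 1 / (8 * v ^ 2) = (1 / v) ^ 2 / 8 := by field_simp
    have e4 : 1 / (2 * v) = (1 / v) / 2 := by field_simp
    rw [e3] at e1
    rw [e4] at e2
    set t := 1 / v
    have e5 : 1 + 1 / u ≤ (1 + t) * (1 - t ^ 2 / 8) := by
      nlinarith [mul_pos hv0 hv0, mul_pos hv0 (mul_pos hv0 hv0)]
    calc X * E * δ * l' * (1 + 1 / u) ≤ X * E * δ * l * ((1 + t) * (1 - t ^ 2 / 8)) := by
          gcongr
      _ = E * δ * l * (1 + t) * X * (1 - t ^ 2 / 8) := by ring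
      _ ≤ u * v * X * (1 - t ^ 2 / 8) := by
          have : 0 ≤ 1 - t ^ 2 / 8 := by nlinarith
          gcongr
      _ ≤ u * v * X * (1 - u / (X * v)) := by gcongr

theorem fold_gap (hβ : 1 < ‖(β : ℂ)‖) (h0 : n 0 = 8) (h2 : ∀ k, 2 * n k ≤ n (k + 1)) (k : ℕ) :
    8 * 2 ^ k ≤ ‖(β : ℂ)‖ ^ (n (k + 1) - n k) := by
  have h3 := eight_mul_two_pow_le h0 h2 k
  have h4 := h2 k
  have h5 : k + 1 ≤ 2 ^ k := Nat.lt_two_pow_self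
  calc (8 * 2 ^ k : ℝ) ≤ 16 ^ (k + 1) := by
        rw [pow_succ, mul_comm]
        have : (2 : ℝ) ^ k ≤ 16 ^ k := by gcongr; norm_num
        have : (0 : ℝ) < 16 ^ k := by positivity
        nlinarith
    _ = (2 ^ 4) ^ (k + 1) := by norm_num
    _ ≤ ((‖(β : ℂ)‖ ^ 2) ^ 4) ^ (k + 1) := by
        have := GaussianInt.two_le_sq_norm_toComplex hβ
        gcongr
    _ = ‖(β : ℂ)‖ ^ (8 * (k + 1)) := by
        rw [← pow_mul, ← pow_mul]; congr 1; ring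
    _ ≤ _ := pow_le_pow_right₀ hβ.le (by omega)

/-- The folding induction. With `E = β ^ n k`, `N = foldNum β n k`, `X = β ^ (n (k + 1) - n k)` and
`Δ = p E - q N`, the next level replaces `(q, Δ)` by `(q, X Δ - q)`; since `E ∣ X`, the pair
`(q - X Δ, Δ)` also comes from level `k`, so the two new coordinates play symmetric roles and the
smaller one may be taken to be `q`. -/
theorem fold_induction (hβ : 1 < ‖(β : ℂ)‖) (h0 : n 0 = 8) (h2 : ∀ k, 2 * n k ≤ n (k + 1))
    {s : GaussianInt} {B : ℕ} (hB : ∀ k, n (k + 1) ≤ 2 * n k + B ∨ s ∣ β ^ n k) {δ : ℝ} (hδ : 0 < δ)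
    (hδB : 64 * ‖(β : ℂ)‖ ^ (8 + B) * δ ≤ 1) (k : ℕ) :
    ∀ p q : GaussianInt, q ≠ 0 → p * β ^ n k - q * foldNum β n k ≠ 0 →
      ¬ (s ∣ q ∧ s ∣ p * β ^ n k - q * foldNum β n k) →
      ‖(β : ℂ)‖ ^ n k * δ * (1 + (1 / 2) ^ k) *
        (1 + 1 / min ‖(q : ℂ)‖ ‖((p * β ^ n k - q * foldNum β n k : GaussianInt) : ℂ)‖) ≤
      ‖(q : ℂ)‖ * ‖((p * β ^ n k - q * foldNum β n k : GaussianInt) : ℂ)‖ := by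
  have hp1 : ∀ e : ℕ, 1 ≤ ‖(β : ℂ)‖ ^ e := fun e => one_le_pow₀ hβ.le
  have hδ64 : δ ≤ 1 / 64 := by nlinarith [hp1 (8 + B)]
  have hmono := strictMono_of_two_mul_le h0 h2
  induction k with
  | zero =>
    intro p q hq hΔ _
    have hu := GaussianInt.one_le_norm_toComplex hq
    have hv := GaussianInt.one_le_norm_toComplex hΔ
    generalize ‖((p * β ^ n 0 - q * foldNum β n 0 : GaussianInt) : ℂ)‖ = v at *
    generalize ‖(q : ℂ)‖ = u at *
    have hm : 1 ≤ min u v := le_min hu hv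
    have h4 : 1 / min u v ≤ 1 := by rw [div_le_one (by linarith)]; exact hm
    have h5 : ‖(β : ℂ)‖ ^ n 0 * δ ≤ 1 / 64 := by
      rw [h0]
      have : ‖(β : ℂ)‖ ^ 8 ≤ ‖(β : ℂ)‖ ^ (8 + B) := pow_le_pow_right₀ hβ.le (by omega)
      nlinarith
    have h6 : 0 < ‖(β : ℂ)‖ ^ n 0 * δ := by have := hp1 (n 0); positivity
    have h7 : 0 < 1 / min u v := by positivity
    simp only [pow_zero]
    nlinarith
  | succ k ih =>
    intro p q hq hΔ' hs
    have h2k := h2 k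
    obtain ⟨x, hx⟩ : ∃ x, n (k + 1) - n k = n k + x := ⟨n (k + 1) - n k - n k, by omega⟩
    have hgap := fold_gap hβ h0 h2 k
    have hEX : ‖(β : ℂ)‖ ^ n k ≤ ‖(β : ℂ)‖ ^ (n (k + 1) - n k) :=
      pow_le_pow_right₀ hβ.le (by omega)
    have hpow : ‖(β : ℂ)‖ ^ n (k + 1) = ‖(β : ℂ)‖ ^ (n (k + 1) - n k) * ‖(β : ℂ)‖ ^ n k := by
      rw [← pow_add]; congr 1; omega
    have hpowβ : β ^ n (k + 1) = β ^ (n (k + 1) - n k) * β ^ n k := by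
      rw [← pow_add]; congr 1; omega
    have hXx : β ^ (n (k + 1) - n k) = β ^ n k * β ^ x := by rw [hx, pow_add]
    set X := β ^ (n (k + 1) - n k) with hX
    have hXnorm : ‖(X : ℂ)‖ = ‖(β : ℂ)‖ ^ (n (k + 1) - n k) := by rw [hX, map_pow, norm_pow]
    rw [← hXnorm] at hgap hEX hpow
    -- one of the two coordinates of level `k + 1`, called `q` again, is the smaller one
    have key : ∀ σ p q : GaussianInt, σ = 1 ∨ σ = -1 → q ≠ 0 →
        ¬ (s ∣ q ∧ s ∣ X * (p * β ^ n k - q * foldNum β n k) + σ * q) →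
        ‖(q : ℂ)‖ ≤ ‖((X * (p * β ^ n k - q * foldNum β n k) + σ * q : GaussianInt) : ℂ)‖ →
        ‖(X : ℂ)‖ * ‖(β : ℂ)‖ ^ n k * δ * (1 + (1 / 2) ^ (k + 1)) * (1 + 1 / min ‖(q : ℂ)‖
          ‖((X * (p * β ^ n k - q * foldNum β n k) + σ * q : GaussianInt) : ℂ)‖) ≤
        ‖(q : ℂ)‖ * ‖((X * (p * β ^ n k - q * foldNum β n k) + σ * q : GaussianInt) : ℂ)‖ := by
      intro σ p q hσ hq hs hle
      have hσq : ‖((σ * q : GaussianInt) : ℂ)‖ = ‖(q : ℂ)‖ := by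
        rcases hσ with rfl | rfl <;> simp
      have hσs : s ∣ σ * q ↔ s ∣ q := by rcases hσ with rfl | rfl <;> simp
      have hu := GaussianInt.one_le_norm_toComplex hq
      have hk1 : (1 / 2 : ℝ) ^ (k + 1) = (1 / 2) ^ k / 2 := by rw [pow_succ]; ring
      have hk0 : (0 : ℝ) < (1 / 2) ^ k := by positivity
      have hk2 : (1 / 2 : ℝ) ^ k ≤ 1 := pow_le_one₀ (by norm_num) (by norm_num)
      by_cases hΔ : p * β ^ n k - q * foldNum β n k = 0
      · have hdvd : β ^ n k ∣ q := by
          refine (isCoprime_foldNum hmono k).dvd_of_dvd_mul_right ⟨p, ?_⟩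
          rw [mul_comm (β ^ n k)]; exact (sub_eq_zero.1 hΔ).symm
        obtain ⟨t, rfl⟩ := hdvd
        rw [hΔ] at hs ⊢
        simp only [mul_zero, zero_add, hσq, hσs, min_self, and_self] at hs ⊢
        have hB' : n (k + 1) ≤ 2 * n k + B := (hB k).resolve_right fun hd => hs (hd.mul_right t)
        have ht := GaussianInt.one_le_norm_toComplex (right_ne_zero_of_mul hq)
        have hXB : ‖(X : ℂ)‖ ≤ ‖(β : ℂ)‖ ^ n k * ‖(β : ℂ)‖ ^ B := by
          rw [hXnorm, ← pow_add]; exact pow_le_pow_right₀ hβ.le (by omega)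
        have hqE : ‖(β : ℂ)‖ ^ n k ≤ ‖((β ^ n k * t : GaussianInt) : ℂ)‖ := by
          rw [map_mul, map_pow, norm_mul, norm_pow]
          nlinarith [hp1 (n k)]
        generalize ‖((β ^ n k * t : GaussianInt) : ℂ)‖ = u at *
        have hE := hp1 (n k)
        set E := ‖(β : ℂ)‖ ^ n k
        have hBδ : ‖(β : ℂ)‖ ^ B * δ ≤ 1 / 64 := by
          have : ‖(β : ℂ)‖ ^ B ≤ ‖(β : ℂ)‖ ^ (8 + B) := pow_le_pow_right₀ hβ.le (by omega)
          nlinarith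
        have h4 : 1 / u ≤ 1 := by rw [div_le_one (by linarith)]; exact hu
        have h5 : 0 < 1 / u := by positivity
        rw [hk1]
        have h6 : (1 + (1 / 2 : ℝ) ^ k / 2) * (1 + 1 / u) ≤ 4 := by nlinarith
        calc ‖(X : ℂ)‖ * E * δ * (1 + (1 / 2) ^ k / 2) * (1 + 1 / u)
            = ‖(X : ℂ)‖ * E * δ * ((1 + (1 / 2) ^ k / 2) * (1 + 1 / u)) := by ring
          _ ≤ (E * ‖(β : ℂ)‖ ^ B) * E * δ * 4 := by gcongr
          _ = E * E * 4 * (‖(β : ℂ)‖ ^ B * δ) := by ring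
          _ ≤ E * E * 4 * (1 / 64) := by gcongr
          _ ≤ u * u := by nlinarith
      · have hv := GaussianInt.one_le_norm_toComplex hΔ
        have hsΔ : ¬ (s ∣ q ∧ s ∣ p * β ^ n k - q * foldNum β n k) := fun hh =>
          hs ⟨hh.1, dvd_add (hh.2.mul_left X) (hσs.2 hh.1)⟩
        have hih := ih p q hq hΔ hsΔ
        refine fold_step_ineq hu hv hle ?_ (hp1 _) hEX hδ hδ64 (by linarith) (l := 1 + (1 / 2) ^ k)
          (by linarith) (by linarith) ?_ hih
        · rw [← norm_mul, ← map_mul]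
          rw [← hσq]
          calc _ = ‖((X * (p * β ^ n k - q * foldNum β n k) + σ * q : GaussianInt) : ℂ) -
                ((σ * q : GaussianInt) : ℂ)‖ := by rw [← map_sub, add_sub_cancel_right]
            _ ≤ _ := norm_sub_le _ _
        · have hc : (1 / 2 : ℝ) ^ k * 2 ^ k = 1 := by rw [← mul_pow]; norm_num
          have hX8 : 2 / ‖(X : ℂ)‖ ≤ (1 / 2) ^ k / 4 := by
            rw [div_le_iff₀ (by linarith [hp1 (n k)])]
            nlinarith
          rw [hk1]
          nlinarith
    have hΔeq : p * β ^ n (k + 1) - q * foldNum β n (k + 1) =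
        X * (p * β ^ n k - q * foldNum β n k) - q := by
      rw [hpowβ, foldNum]; ring
    rw [hΔeq] at hΔ' hs ⊢
    rw [hpow]
    rcases le_total ‖(q : ℂ)‖
      ‖((X * (p * β ^ n k - q * foldNum β n k) - q : GaussianInt) : ℂ)‖ with hle | hle
    · have e : X * (p * β ^ n k - q * foldNum β n k) - q =
          X * (p * β ^ n k - q * foldNum β n k) + -1 * q := by ring
      rw [e] at hs hle ⊢
      exact key (-1) p q (Or.inr rfl) hq hs hle
    · -- the mirror image: `q` and `Δ'` change places, up to sign
      set Δ := p * β ^ n k - q * foldNum β n k with hΔ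
      have e1 : (p - β ^ x * Δ * foldNum β n k) * β ^ n k - (q - X * Δ) * foldNum β n k = Δ := by
        rw [hXx, hΔ]; ring
      have e2 : X * Δ + 1 * (q - X * Δ) = q := by ring
      have e3 : ‖((q - X * Δ : GaussianInt) : ℂ)‖ = ‖((X * Δ - q : GaussianInt) : ℂ)‖ := by
        rw [← neg_sub, map_neg, norm_neg]
      have hm := key 1 (p - β ^ x * Δ * foldNum β n k) (q - X * Δ) (Or.inl rfl)
        (by rw [← neg_sub]; exact neg_ne_zero.2 hΔ')
      rw [e1, e2, e3] at hm
      rw [min_comm, mul_comm ‖(q : ℂ)‖]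
      refine hm (fun hh => hs ⟨hh.2, ?_⟩) hle
      rw [← neg_sub]; exact (dvd_neg).2 hh.1

/-- A lacunary sum whose exponents satisfy `n (k + 1) ≤ 2 * n k + B` is badly approximable.
Exceptional indices `k` with larger jumps only spoil this for denominators divisible by any common
divisor `s` of the corresponding powers `β ^ n k`. -/
theorem foldSum_lower_bound (hβ : 1 < ‖(β : ℂ)‖) (h0 : n 0 = 8) (h2 : ∀ k, 2 * n k ≤ n (k + 1))
    {s : GaussianInt} {B : ℕ} (hB : ∀ k, n (k + 1) ≤ 2 * n k + B ∨ s ∣ β ^ n k)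
    {p q : GaussianInt} (hq : q ≠ 0) (hs : ¬ s ∣ q) :
    (64 * ‖(β : ℂ)‖ ^ (8 + B))⁻¹ ≤ ‖(q : ℂ)‖ ^ 2 * ‖foldSum β n - (p : ℂ) / q‖ := by
  have hmono := strictMono_of_two_mul_le h0 h2
  have hβ0 : β ≠ 0 := ne_zero_of_one_lt_norm hβ
  have hb : (β : ℂ) ≠ 0 := by simpa using hβ0
  have hqc : (q : ℂ) ≠ 0 := by simpa using hq
  have hp : 0 < 64 * ‖(β : ℂ)‖ ^ (8 + B) := by positivity
  have hlim : Tendsto (fun k => (foldNum β n k : ℂ) / (β : ℂ) ^ n k) atTop (𝓝 (foldSum β n)) := by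
    simp_rw [foldNum_div hβ0 hmono.monotone]
    exact ((summable_foldSum hβ hmono).hasSum.tendsto_sum_nat).comp (tendsto_add_atTop_nat 1)
  have hlim' := ((hlim.sub_const ((p : ℂ) / q)).norm.const_mul (‖(q : ℂ)‖ ^ 2))
  refine ge_of_tendsto_of_frequently hlim' ?_
  -- `p / q` cannot equal two consecutive partial sums
  rw [frequently_atTop]
  have hnext : ∀ k, p * β ^ n k - q * foldNum β n k = 0 →
      p * β ^ n (k + 1) - q * foldNum β n (k + 1) ≠ 0 := by
    intro k hk h'
    have hpowβ : β ^ n (k + 1) = β ^ (n (k + 1) - n k) * β ^ n k := by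
      rw [← pow_add]; congr 1; have := h2 k; omega
    have : p * β ^ n (k + 1) - q * foldNum β n (k + 1) =
        β ^ (n (k + 1) - n k) * (p * β ^ n k - q * foldNum β n k) - q := by
      rw [hpowβ, foldNum]; ring
    rw [this, hk] at h'
    exact hq (by simpa using h')
  have hgood : ∀ k, p * β ^ n k - q * foldNum β n k ≠ 0 → (64 * ‖(β : ℂ)‖ ^ (8 + B))⁻¹ ≤
      ‖(q : ℂ)‖ ^ 2 * ‖(foldNum β n k : ℂ) / (β : ℂ) ^ n k - (p : ℂ) / q‖ := by
    intro k hk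
    have h := fold_induction hβ h0 h2 hB (inv_pos.2 hp) (mul_inv_cancel₀ hp.ne').le k p q hq hk
      fun hh => hs hh.1
    have hv := GaussianInt.one_le_norm_toComplex hk
    have hu := GaussianInt.one_le_norm_toComplex hq
    have e : (foldNum β n k : ℂ) / (β : ℂ) ^ n k - (p : ℂ) / q =
        -(((p * β ^ n k - q * foldNum β n k : GaussianInt) : ℂ) / (q * (β : ℂ) ^ n k)) := by
      rw [map_sub, map_mul, map_mul, map_pow]; field_simp; ring
    rw [e, norm_neg, norm_div, norm_mul, norm_pow]
    generalize ‖((p * β ^ n k - q * foldNum β n k : GaussianInt) : ℂ)‖ = v at *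
    generalize ‖(q : ℂ)‖ = u at *
    have e2 : u ^ 2 * (v / (u * ‖(β : ℂ)‖ ^ n k)) = u * v / ‖(β : ℂ)‖ ^ n k := by field_simp
    have hE : 0 < ‖(β : ℂ)‖ ^ n k := by positivity
    rw [e2, le_div_iff₀ hE]
    refine le_trans ?_ h
    have hm : 0 < min u v := lt_min (by linarith) (by linarith)
    have h3 : 1 ≤ 1 + 1 / min u v := by have : 0 < 1 / min u v := by positivity
                                        linarith
    have h4 : (1 : ℝ) ≤ 1 + (1 / 2) ^ k := by have : (0 : ℝ) < (1 / 2) ^ k := by positivity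
                                              linarith
    have h5 : 1 ≤ (1 + (1 / 2 : ℝ) ^ k) * (1 + 1 / min u v) := one_le_mul_of_one_le_of_one_le h4 h3
    rw [mul_assoc (_ * _), mul_comm]
    exact le_mul_of_one_le_right (by positivity) h5
  intro K
  by_cases hK : p * β ^ n K - q * foldNum β n K = 0
  · exact ⟨K + 1, Nat.le_succ K, hgood _ (hnext K hK)⟩
  · exact ⟨K, le_rfl, hgood K hK⟩

end Fold

/-! ### Points with lacunary digit changes, and changes of their exponents -/

/-- The points of the construction: `a / (β - 1) + d ∑_k β ^ (-n k)`. In base `β` it is the number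
with the digit `a + d` at the positions `n k` and the digit `a` elsewhere. -/
noncomputable def foldPoint (β a d : GaussianInt) (n : ℕ → ℕ) : ℂ :=
  (a : ℂ) / ((β : ℂ) - 1) + d * foldSum β n

/-- The rational `a / (β - 1) + d ∑_{k ≤ j} β ^ (-n k)`. -/
noncomputable def foldPartial (β a d : GaussianInt) (n : ℕ → ℕ) (j : ℕ) : ℂ :=
  (a : ℂ) / ((β : ℂ) - 1) + d * ((foldNum β n j : ℂ) / (β : ℂ) ^ n j)

/-- Replace the exponents after the index `j`: the next exponent is `2 * n j + m`, and the later
ones are chosen such that their differences depend on `L` alone. -/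
def refold (n : ℕ → ℕ) (j m L : ℕ) (k : ℕ) : ℕ :=
  if k ≤ j then n k else 2 * n j + m + L * (2 ^ (k - (j + 1)) - 1)

section Refold

variable {n : ℕ → ℕ} {j m M : ℕ}

theorem refold_of_le {L k : ℕ} (h : k ≤ j) : refold n j m L k = n k := if_pos h

theorem refold_add {L : ℕ} (i : ℕ) :
    refold n j m L (i + (j + 1)) = 2 * n j + m + L * (2 ^ i - 1) := by
  rw [refold, if_neg (by omega), Nat.add_sub_cancel]

theorem refold_succ_of_gt (hm : m ≤ M) {k : ℕ} (h : j < k) :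
    refold n j m (2 * n j + M) (k + 1) = 2 * refold n j m (2 * n j + M) k + (M - m) := by
  obtain ⟨i, rfl⟩ := Nat.exists_eq_add_of_le' h
  rw [add_right_comm, refold_add, refold_add, pow_succ]
  obtain ⟨t, ht⟩ : ∃ t, 2 ^ i = t + 1 := 
    ⟨2 ^ i - 1, (Nat.sub_add_cancel Nat.one_le_two_pow).symm⟩
  have : (t + 1) * 2 - 1 = 2 * t + 1 := by omega
  rw [ht, this, Nat.add_sub_cancel]
  obtain ⟨e, rfl⟩ := Nat.exists_eq_add_of_le hm
  rw [Nat.add_sub_cancel_left]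
  ring

theorem refold_succ_self {L : ℕ} : refold n j m L (j + 1) = 2 * n j + m := by
  simpa using refold_add (n := n) (j := j) (m := m) (L := L) 0

theorem two_mul_refold_le (h2 : ∀ k, 2 * n k ≤ n (k + 1)) (hm : m ≤ M) (k : ℕ) :
    2 * refold n j m (2 * n j + M) k ≤ refold n j m (2 * n j + M) (k + 1) := by
  rcases lt_trichotomy k j with h | rfl | h
  · rw [refold_of_le h.le, refold_of_le h]; exact h2 k
  · rw [refold_of_le le_rfl, refold_succ_self]; omega
  · rw [refold_succ_of_gt hm h]; omega

theorem refold_succ_le {B : ℕ} (hB : ∀ k, n (k + 1) ≤ 2 * n k + B) (hm : m ≤ M) (hMm : M - m ≤ B)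
    (k : ℕ) (hk : k ≠ j) :
    refold n j m (2 * n j + M) (k + 1) ≤ 2 * refold n j m (2 * n j + M) k + B := by
  rcases lt_or_gt_of_ne hk with h | h
  · rw [refold_of_le h.le, refold_of_le h]; exact hB k
  · rw [refold_succ_of_gt hm h]; omega

end Refold

section Point

variable {β a d : GaussianInt} {n : ℕ → ℕ}

/-- The folding bound for `foldPoint`: a fraction `p / q` near it is a fraction with denominator
`q (β - 1) d` near `foldSum`. -/
theorem foldPoint_lower_bound (hβ : 1 < ‖(β : ℂ)‖) (hd : d ≠ 0) (h0 : n 0 = 8)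
    (h2 : ∀ k, 2 * n k ≤ n (k + 1)) {s : GaussianInt} {B : ℕ}
    (hB : ∀ k, n (k + 1) ≤ 2 * n k + B ∨ s ∣ β ^ n k) {p q : GaussianInt} (hq : q ≠ 0)
    (hs : ¬ s ∣ q * ((β - 1) * d)) :
    (64 * ‖(β : ℂ)‖ ^ (8 + B) * (‖(β : ℂ) - 1‖ ^ 2 * ‖(d : ℂ)‖))⁻¹ ≤
      ‖(q : ℂ)‖ ^ 2 * ‖foldPoint β a d n - (p : ℂ) / q‖ := by
  have hβ1 := gaussian_sub_one_ne_zero_of_one_lt_norm hβ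
  have hb1 := sub_one_ne_zero_of_one_lt_norm hβ
  have hdc : (d : ℂ) ≠ 0 := by rwa [Ne, GaussianInt.toComplex_eq_zero]
  have hqc : (q : ℂ) ≠ 0 := by rwa [Ne, GaussianInt.toComplex_eq_zero]
  have h := foldSum_lower_bound hβ h0 h2 hB (p := p * (β - 1) - q * a)
    (mul_ne_zero hq (mul_ne_zero hβ1 hd)) hs
  have e : foldSum β n - ((p * (β - 1) - q * a : GaussianInt) : ℂ) /
      ((q * ((β - 1) * d) : GaussianInt) : ℂ) = (foldPoint β a d n - (p : ℂ) / q) / d := by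
    simp only [map_sub, map_mul, map_one, foldPoint]
    field_simp
    ring
  rw [e, norm_div, map_mul, map_mul, map_sub, map_one, norm_mul, norm_mul] at h
  have hb1' : 0 < ‖(β : ℂ) - 1‖ := norm_pos_iff.2 hb1
  have hdc' : 0 < ‖(d : ℂ)‖ := norm_pos_iff.2 hdc
  rw [mul_inv, ← div_eq_mul_inv, div_le_iff₀ (by positivity)]
  refine h.trans (le_of_eq ?_)
  field_simp

theorem foldPoint_eq_partial_add (hβ : 1 < ‖(β : ℂ)‖) (h : StrictMono n) (j : ℕ) :
    foldPoint β a d n = foldPartial β a d n j + d * ∑' i, ((β : ℂ) ^ n (i + (j + 1)))⁻¹ := by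
  have hβ0 : β ≠ 0 := ne_zero_of_one_lt_norm hβ
  rw [foldPoint, foldPartial, foldNum_div hβ0 h.monotone, foldSum,
    ← (summable_foldSum hβ h).sum_add_tsum_nat_add (j + 1)]
  ring

theorem foldPartial_congr {n' : ℕ → ℕ} {j : ℕ} (hβ : β ≠ 0) (h : Monotone n) (h' : Monotone n')
    (hn : ∀ k ≤ j, n' k = n k) : foldPartial β a d n' j = foldPartial β a d n j := by
  rw [foldPartial, foldPartial, foldNum_div hβ h, foldNum_div hβ h']
  congr 2
  exact Finset.sum_congr rfl fun i hi => by rw [hn i (by simpa [Nat.lt_succ_iff] using hi)]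

theorem norm_foldPoint_sub_partial_le (hβ : 1 < ‖(β : ℂ)‖) (h : StrictMono n) (j : ℕ) :
    ‖foldPoint β a d n - foldPartial β a d n j‖ ≤
      ‖(d : ℂ)‖ * ((‖(β : ℂ)‖ ^ n (j + 1))⁻¹ * (1 - ‖(β : ℂ)‖⁻¹)⁻¹) := by
  rw [foldPoint_eq_partial_add hβ h j, add_sub_cancel_left, norm_mul]
  gcongr
  exact norm_tsum_tail_le hβ h (j + 1)

/-- Increasing `m` by one moves the refolded point towards the partial sum by the exact factor
`β⁻¹`. -/
theorem foldPoint_refold_succ (hβ : 1 < ‖(β : ℂ)‖) (h0 : n 0 = 8)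
    (h2 : ∀ k, 2 * n k ≤ n (k + 1)) {j m M : ℕ} (hm : m < M) :
    foldPoint β a d (refold n j m (2 * n j + M)) - foldPartial β a d n j =
      β * (foldPoint β a d (refold n j (m + 1) (2 * n j + M)) - foldPartial β a d n j) := by
  have hβ0 : β ≠ 0 := ne_zero_of_one_lt_norm hβ
  have hb : (β : ℂ) ≠ 0 := by rwa [Ne, GaussianInt.toComplex_eq_zero]
  have hmono := (strictMono_of_two_mul_le h0 h2).monotone
  have key : ∀ m ≤ M, foldPoint β a d (refold n j m (2 * n j + M)) - foldPartial β a d n j =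
      d * (((β : ℂ) ^ (2 * n j + m))⁻¹ * ∑' i, ((β : ℂ) ^ ((2 * n j + M) * (2 ^ i - 1)))⁻¹) := by
    intro m hm
    have hs := strictMono_of_two_mul_le (n := refold n j m (2 * n j + M))
      (by rw [refold_of_le (Nat.zero_le _), h0]) (two_mul_refold_le h2 hm)
    rw [foldPoint_eq_partial_add hβ hs j,
      foldPartial_congr hβ0 hmono hs.monotone fun k hk => refold_of_le hk, add_sub_cancel_left]
    simp_rw [refold_add, pow_add _ (2 * n j + m), mul_inv, tsum_mul_left]
  rw [key m hm.le, key (m + 1) hm, ← add_assoc, pow_succ]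
  field_simp

/-- If `β ^ n j` divides `q (β - 1) d`, then multiplication by `(β - 1) q` clears all denominators
of the partial sum; consequently `r + β (p / q - r)` has the denominator `q`. -/
theorem sub_one_mul_foldPartial (hβ : 1 < ‖(β : ℂ)‖) {j : ℕ} {q t : GaussianInt}
    (ht : q * ((β - 1) * d) = β ^ n j * t) :
    ((β : ℂ) - 1) * q * foldPartial β a d n j = ((q * a + foldNum β n j * t : GaussianInt) : ℂ) := by
  have hβ0 : β ≠ 0 := ne_zero_of_one_lt_norm hβ
  have hb : (β : ℂ) ≠ 0 := by rwa [Ne, GaussianInt.toComplex_eq_zero]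
  have hb1 : (β : ℂ) - 1 ≠ 0 := sub_one_ne_zero_of_one_lt_norm hβ
  have ht' : (q : ℂ) * (((β : ℂ) - 1) * d) = (β : ℂ) ^ n j * t := by
    have := congrArg (GaussianInt.toComplex) ht
    simpa using this
  rw [foldPartial, map_add, map_mul, map_mul]
  have e : ((β : ℂ) - 1) * q * ((a : ℂ) / ((β : ℂ) - 1) + d * ((foldNum β n j : ℂ) / (β : ℂ) ^ n j)) =
      q * a + (q * (((β : ℂ) - 1) * d)) * foldNum β n j / (β : ℂ) ^ n j := by
    field_simp
  rw [e, ht']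
  field_simp

theorem dvd_of_foldPartial_eq (hβ : 1 < ‖(β : ℂ)‖) (h : StrictMono n) {j : ℕ} {p q : GaussianInt}
    (hq : q ≠ 0) (he : foldPartial β a d n j = (p : ℂ) / q) : β ^ n j ∣ q * ((β - 1) * d) := by
  have hβ0 : β ≠ 0 := ne_zero_of_one_lt_norm hβ
  have hb : (β : ℂ) ≠ 0 := by rwa [Ne, GaussianInt.toComplex_eq_zero]
  have hb1 : (β : ℂ) - 1 ≠ 0 := sub_one_ne_zero_of_one_lt_norm hβ
  have hqc : (q : ℂ) ≠ 0 := by rwa [Ne, GaussianInt.toComplex_eq_zero]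
  refine (isCoprime_foldNum h j).dvd_of_dvd_mul_right ⟨p * (β - 1) - q * a, ?_⟩
  rw [← GaussianInt.toComplex_inj]
  rw [foldPartial] at he
  simp only [map_mul, map_sub, map_pow, map_one]
  field_simp at he
  linear_combination he

/-- Every partial sum has a representation with a denominator of least absolute value. -/
theorem exists_min_denominator (hβ : 1 < ‖(β : ℂ)‖) (j : ℕ) :
    ∃ p q : GaussianInt, q ≠ 0 ∧ foldPartial β a d n j = (p : ℂ) / q ∧
      ‖(q : ℂ)‖ ≤ ‖(β : ℂ) - 1‖ * ‖(β : ℂ)‖ ^ n j ∧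
      ∀ p' q' : GaussianInt, q' ≠ 0 → foldPartial β a d n j = (p' : ℂ) / q' →
        ‖(q : ℂ)‖ ≤ ‖(q' : ℂ)‖ := by
  have hβ0 : β ≠ 0 := ne_zero_of_one_lt_norm hβ
  have hβ1 := gaussian_sub_one_ne_zero_of_one_lt_norm hβ
  have hb : (β : ℂ) ≠ 0 := by rwa [Ne, GaussianInt.toComplex_eq_zero]
  have hb1 : (β : ℂ) - 1 ≠ 0 := sub_one_ne_zero_of_one_lt_norm hβ
  set R := ‖(β : ℂ) - 1‖ * ‖(β : ℂ)‖ ^ n j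
  let T : Set GaussianInt := {q | q ≠ 0 ∧ (∃ p : GaussianInt, foldPartial β a d n j = (p : ℂ) / q) ∧
    ‖(q : ℂ)‖ ≤ R}
  have hT : T.Finite := (GaussianInt.finite_norm_le R).subset fun q hq => hq.2.2
  have hne : T.Nonempty := by
    refine ⟨(β - 1) * β ^ n j, mul_ne_zero hβ1 (pow_ne_zero _ hβ0),
      ⟨a * β ^ n j + (β - 1) * d * foldNum β n j, ?_⟩, le_of_eq ?_⟩
    · rw [foldPartial]
      simp only [map_add, map_mul, map_sub, map_pow, map_one]
      field_simp
    · simp [R]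
  obtain ⟨q, hqT, hmin⟩ := Set.exists_min_image T (fun q => ‖(q : ℂ)‖) hT hne
  obtain ⟨hq, ⟨p, hp⟩, hR⟩ := hqT
  refine ⟨p, q, hq, hp, hR, fun p' q' hq' he => ?_⟩
  rcases le_or_gt ‖(q' : ℂ)‖ R with hc | hc
  · exact hmin q' ⟨hq', ⟨p', he⟩, hc⟩
  · exact hR.trans hc.le

end Point

/-! ### Strict avoidance -/

/-- `Ψ ‖q‖ < |ζ - p / q|` for all Gaussian rationals with `Q ≤ ‖q‖`. -/
def StrictlyAvoids (Ψ : ℝ → ℝ) (Q : ℝ) (ζ : ℂ) : Prop :=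
  ∀ p q : GaussianInt, Q ≤ ‖(q : ℂ)‖ → Ψ ‖(q : ℂ)‖ < ‖ζ - (p : ℂ) / q‖

theorem lt_norm_sub_div_of_large {p q : GaussianInt} {z : ℂ} {R T : ℝ} (hq : 1 ≤ ‖(q : ℂ)‖)
    (hR : ‖(q : ℂ)‖ ≤ R) (h : R * (‖z‖ + T) < ‖(p : ℂ)‖) (hT : 0 ≤ T) :
    T < ‖z - (p : ℂ) / q‖ := by
  have h1 : ‖(p : ℂ) / q‖ ≤ ‖z - (p : ℂ) / q‖ + ‖z‖ := by
    have := norm_sub_le z (z - (p : ℂ) / q)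
    rw [sub_sub_cancel] at this; linarith
  have h2 : ‖z‖ + T < ‖(p : ℂ) / q‖ := by
    rw [norm_div, lt_div_iff₀ (by linarith)]
    have := norm_nonneg z
    nlinarith
  linarith

/-- For denominators in a bounded range only finitely many fractions matter, so the strict
inequalities persist near a given point. -/
theorem StrictlyAvoids.exists_nhds {Ψ : ℝ → ℝ} {Q : ℝ} (hQ : 1 ≤ Q) {ζ : ℂ}
    (h : StrictlyAvoids Ψ Q ζ) (R : ℝ) :
    ∃ ε > 0, ∀ ζ' : ℂ, ‖ζ' - ζ‖ < ε → ∀ p q : GaussianInt, Q ≤ ‖(q : ℂ)‖ → ‖(q : ℂ)‖ ≤ R →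
      Ψ ‖(q : ℂ)‖ < ‖ζ' - (p : ℂ) / q‖ := by
  have hq := GaussianInt.finite_norm_le R
  obtain ⟨T, hT⟩ := (hq.image fun q : GaussianInt => Ψ ‖(q : ℂ)‖).bddAbove
  have hT' : ∀ q : GaussianInt, ‖(q : ℂ)‖ ≤ R → Ψ ‖(q : ℂ)‖ ≤ max T 0 := fun q hqR =>
    (hT ⟨q, hqR, rfl⟩).trans (le_max_left _ _)
  have hp := GaussianInt.finite_norm_le (R * (‖ζ‖ + 1 + max T 0))
  have hev : ∀ᶠ ζ' in 𝓝 ζ, ∀ x ∈ {z : GaussianInt | ‖(z : ℂ)‖ ≤ R * (‖ζ‖ + 1 + max T 0)} ×ˢ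
      {z : GaussianInt | ‖(z : ℂ)‖ ≤ R}, Q ≤ ‖(x.2 : ℂ)‖ →
      Ψ ‖(x.2 : ℂ)‖ < ‖ζ' - (x.1 : ℂ) / x.2‖ := by
    rw [eventually_all_finite (hp.prod hq)]
    intro x _
    by_cases hx : Q ≤ ‖(x.2 : ℂ)‖
    · have hc : Tendsto (fun ζ' : ℂ => ‖ζ' - (x.1 : ℂ) / x.2‖) (𝓝 ζ) (𝓝 ‖ζ - (x.1 : ℂ) / x.2‖) :=
        (Continuous.tendsto (by fun_prop) ζ)
      filter_upwards [hc.eventually_const_lt (h x.1 x.2 hx)] with ζ' hζ' _ using hζ'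
    · exact Eventually.of_forall fun _ hx' => absurd hx' hx
  obtain ⟨ε, hε, hball⟩ := Metric.eventually_nhds_iff.1 hev
  refine ⟨min ε 1, by positivity, fun ζ' hζ' p q hQq hqR => ?_⟩
  by_cases hpR : ‖(p : ℂ)‖ ≤ R * (‖ζ‖ + 1 + max T 0)
  · exact hball (by rw [dist_eq_norm]; exact hζ'.trans_le (min_le_left _ _)) (p, q) ⟨hpR, hqR⟩ hQq
  · push Not at hpR
    refine (hT' q hqR).trans_lt (lt_norm_sub_div_of_large (hQ.trans hQq) hqR ?_
      (le_max_right _ _))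
    refine lt_of_le_of_lt ?_ hpR
    have h1 : ‖ζ'‖ ≤ ‖ζ‖ + 1 := by
      have := norm_add_le (ζ' - ζ) ζ
      rw [sub_add_cancel] at this
      have := hζ'.trans_le (min_le_right ε 1)
      linarith
    have : 0 ≤ R := (norm_nonneg _).trans hqR
    gcongr

/-! ### The window argument -/

/-- Around a partial sum, fractions with a smaller denominator than that of the partial sum itself
stay at a controlled distance. -/
theorem lower_bound_of_norm_lt {p q p' q' : GaussianInt} {z r : ℂ} (hq : q ≠ 0) (hq' : q' ≠ 0)
    (hr : r = (p' : ℂ) / q') (hne : r ≠ (p : ℂ) / q) :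
    ‖(q : ℂ)‖ / ‖(q' : ℂ)‖ - ‖(q : ℂ)‖ ^ 2 * ‖z - r‖ ≤ ‖(q : ℂ)‖ ^ 2 * ‖z - (p : ℂ) / q‖ := by
  have hqc : (q : ℂ) ≠ 0 := by rwa [Ne, GaussianInt.toComplex_eq_zero]
  have hqc' : (q' : ℂ) ≠ 0 := by rwa [Ne, GaussianInt.toComplex_eq_zero]
  have h1 : 1 ≤ ‖((p' * q - p * q' : GaussianInt) : ℂ)‖ := by
    refine GaussianInt.one_le_norm_toComplex fun h => hne ?_
    rw [hr, div_eq_div_iff hqc' hqc, ← sub_eq_zero]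
    simpa using congrArg GaussianInt.toComplex h
  have h2 : r - (p : ℂ) / q = ((p' * q - p * q' : GaussianInt) : ℂ) / (q' * q) := by
    rw [hr]; simp only [map_sub, map_mul]; field_simp
  have h3 : ‖r - (p : ℂ) / q‖ ≤ ‖z - r‖ + ‖z - (p : ℂ) / q‖ := by
    have := norm_sub_le (z - (p : ℂ) / q) (z - r)
    rw [sub_sub_sub_cancel_left] at this; linarith
  have hn : 0 < ‖(q : ℂ)‖ := norm_pos_iff.2 hqc
  have hn' : 0 < ‖(q' : ℂ)‖ := norm_pos_iff.2 hqc'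
  have h4 : ‖(q : ℂ)‖ / ‖(q' : ℂ)‖ ≤ ‖(q : ℂ)‖ ^ 2 * ‖r - (p : ℂ) / q‖ := by
    rw [h2, norm_div, norm_mul, ← mul_div_assoc, div_le_div_iff₀ hn' (by positivity)]
    have : ‖(q : ℂ)‖ * (‖(q' : ℂ)‖ * ‖(q : ℂ)‖) * 1 ≤ ‖(q : ℂ)‖ * (‖(q' : ℂ)‖ * ‖(q : ℂ)‖) *
      ‖((p' * q - p * q' : GaussianInt) : ℂ)‖ := by gcongr
    linarith
  nlinarith [pow_pos hn 2]

theorem lt_of_sq_mul_lt {x u y : ℝ} (hx : 0 < x) (h : x ^ 2 * u < x ^ 2 * y) : u < y :=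
  lt_of_mul_lt_mul_left h (by positivity)

/-- The states of the construction: points `foldPoint β a d n` with bounded jumps
`n (k + 1) - 2 * n k` that strictly avoid `c Ψ`. -/
def IsStage (β a d : GaussianInt) (Ψ : ℝ → ℝ) (c Q : ℝ) (ζ : ℂ) : Prop :=
  ∃ (n : ℕ → ℕ) (B : ℕ), n 0 = 8 ∧ (∀ k, 2 * n k ≤ n (k + 1)) ∧ (∀ k, n (k + 1) ≤ 2 * n k + B) ∧
    ζ = foldPoint β a d n ∧ StrictlyAvoids (fun x => c * Ψ x) Q ζ

section Step

variable {β a d : GaussianInt} {Ψ : ℝ → ℝ} {c Q : ℝ}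

theorem foldPoint_lower_bound_all (hβ : 1 < ‖(β : ℂ)‖) (hd : d ≠ 0) {n : ℕ → ℕ} (h0 : n 0 = 8)
    (h2 : ∀ k, 2 * n k ≤ n (k + 1)) {B : ℕ}
    (hB : ∀ k, n (k + 1) ≤ 2 * n k + B) {p q : GaussianInt} (hq : q ≠ 0) :
    (64 * ‖(β : ℂ)‖ ^ (8 + B) * (‖(β : ℂ) - 1‖ ^ 2 * ‖(d : ℂ)‖))⁻¹ ≤
      ‖(q : ℂ)‖ ^ 2 * ‖foldPoint β a d n - (p : ℂ) / q‖ := by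
  have hβ1 := gaussian_sub_one_ne_zero_of_one_lt_norm hβ
  refine foldPoint_lower_bound hβ hd h0 h2 (s := 0) (fun k => Or.inl (hB k)) hq ?_
  rw [zero_dvd_iff]
  exact mul_ne_zero hq (mul_ne_zero hβ1 hd)

/-- The exponents `8 * 2 ^ k` have no excess jumps at all, so they give a badly approximable point. -/
theorem exists_isStage (hβ : 1 < ‖(β : ℂ)‖) (hd : d ≠ 0)
    (hlim : Tendsto (fun x : ℝ => x ^ 2 * Ψ x) atTop (𝓝 0)) (hc0 : 0 < c) (hc1 : c < 1) :
    ∃ Q > 1, ∃ ζ, IsStage β a d Ψ c Q ζ := by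
  have hβ1 : 0 < ‖(β : ℂ) - 1‖ := norm_pos_iff.2 (sub_one_ne_zero_of_one_lt_norm hβ)
  have hd' : 0 < ‖(d : ℂ)‖ := by rwa [norm_pos_iff, Ne, GaussianInt.toComplex_eq_zero]
  set κ := (64 * ‖(β : ℂ)‖ ^ (8 + 0) * (‖(β : ℂ) - 1‖ ^ 2 * ‖(d : ℂ)‖))⁻¹
  have hκ : 0 < κ := by positivity
  obtain ⟨Q, hQ⟩ := eventually_atTop.1 ((hlim.const_mul c).eventually_lt_const
    (show c * 0 < κ by simpa using hκ))
  have h0 : (fun k : ℕ => 8 * 2 ^ k) 0 = 8 := by simp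
  have h2 : ∀ k : ℕ, 8 * 2 ^ (k + 1) = 2 * (8 * 2 ^ k) := fun k => by ring
  refine ⟨max Q 2, lt_of_lt_of_le one_lt_two (le_max_right _ _), _, fun k => 8 * 2 ^ k, 0, h0,
    fun k => (h2 k).ge, fun k => (h2 k).le, rfl, fun p q hq => ?_⟩
  have hq2 : 2 ≤ ‖(q : ℂ)‖ := (le_max_right _ _).trans hq
  have hq0 : q ≠ 0 := by rintro rfl; norm_num at hq2
  have h := foldPoint_lower_bound_all (a := a) (p := p) hβ hd h0 (fun k => (h2 k).ge)
    (B := 0) (fun k => (h2 k).le) hq0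
  refine lt_of_sq_mul_lt (by linarith) (lt_of_lt_of_le ?_ h)
  have := hQ _ ((le_max_left _ _).trans hq)
  linarith

set_option maxHeartbeats 1000000 in
/-- From a stage, arbitrarily close by, there is a different stage with a fraction that
approximates it better than `Ψ`, and as closely as desired. -/
theorem IsStage.exists_next (hβ : 1 < ‖(β : ℂ)‖) (hd : d ≠ 0)
    (hpos : ∀ x : ℝ, 1 < x → 0 < Ψ x)
    (hanti : AntitoneOn (fun x : ℝ => x ^ 2 * Ψ x) (Set.Ioi 1))
    (hlim : Tendsto (fun x : ℝ => x ^ 2 * Ψ x) atTop (𝓝 0)) (hc0 : 0 < c)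
    (hc : c * ‖(β : ℂ)‖ < 1) (hQ : 1 < Q) {ζ : ℂ} (hζ : IsStage β a d Ψ c Q ζ) {ε : ℝ}
    (hε : 0 < ε) :
    ∃ ζ', IsStage β a d Ψ c Q ζ' ∧ ‖ζ' - ζ‖ < ε ∧ ζ' ≠ ζ ∧
      ∃ p q : GaussianInt, Q ≤ ‖(q : ℂ)‖ ∧ ‖ζ' - (p : ℂ) / q‖ < Ψ ‖(q : ℂ)‖ ∧
        ‖ζ' - (p : ℂ) / q‖ < ε := by
  obtain ⟨n, B₀, h0, h2, hB₀, rfl, hav⟩ := hζ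
  have hmono := strictMono_of_two_mul_le h0 h2
  have hβ0 : β ≠ 0 := ne_zero_of_one_lt_norm hβ
  have hβ1 : 0 < ‖(β : ℂ) - 1‖ := norm_pos_iff.2 (sub_one_ne_zero_of_one_lt_norm hβ)
  have hd' : 0 < ‖(d : ℂ)‖ := by rwa [norm_pos_iff, Ne, GaussianInt.toComplex_eq_zero]
  have hβ1' : 1 ≤ ‖(β : ℂ) - 1‖ := by
    simpa using GaussianInt.one_le_norm_toComplex (gaussian_sub_one_ne_zero_of_one_lt_norm hβ)
  have hd1 : 1 ≤ ‖(d : ℂ)‖ := GaussianInt.one_le_norm_toComplex hd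
  set w := ‖(β : ℂ)‖ with hw
  have hw0 : 0 < w := by linarith
  have hwp : ∀ e : ℕ, 0 < w ^ e := fun e => by positivity
  set K := ‖(β : ℂ) - 1‖ ^ 2 * ‖(d : ℂ)‖ with hK
  set H := (1 - w⁻¹)⁻¹
  have hH0 : 0 < H := inv_pos.2 (sub_pos.2 (inv_lt_one_of_one_lt₀ hβ))
  have hK1 : 1 ≤ K := one_le_mul_of_one_le_of_one_le (one_le_pow₀ hβ1') hd1
  have hK0 : 0 < K := by linarith
  have hc1 : c < 1 := by nlinarith
  have hφpos : ∀ x : ℝ, 1 < x → 0 < x ^ 2 * Ψ x := fun x hx => by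
    have := hpos x hx
    positivity
  -- the width of the window of jumps `m` in which the stage breaks down
  obtain ⟨C, hC⟩ := pow_unbounded_of_one_lt (64 * w ^ 8 * K ^ 2 * H) hβ
  -- after refolding, the later jumps are `M - m ≤ C + 1`, so the bound has to cover these as well
  set B := max B₀ (C + 1)
  have hB : ∀ k, n (k + 1) ≤ 2 * n k + B := fun k =>
    (hB₀ k).trans (Nat.add_le_add_left (le_max_left _ _) _)
  have hCB : C + 1 ≤ B := le_max_right _ _
  let κ : ℕ → ℝ := fun e => (64 * w ^ (8 + e) * K)⁻¹
  have hκ0 : ∀ e, 0 < κ e := fun e => by positivity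
  obtain ⟨Q₁, hQ₁⟩ := eventually_atTop.1 ((hlim.eventually_lt_const (hκ0 B)).and
    (hlim.eventually_lt_const hε))
  set R := max Q₁ Q with hR
  have hR1 : 1 < R := hQ.trans_le (le_max_right _ _)
  have hφκ : ∀ x, R ≤ x → x ^ 2 * Ψ x < κ B := fun x hx => (hQ₁ x ((le_max_left _ _).trans hx)).1
  have hΨε : ∀ x, R ≤ x → Ψ x < ε := fun x hx => by
    have h1 := (hQ₁ x ((le_max_left _ _).trans hx)).2
    have h3 := hpos x (hR1.trans_le hx)
    have : 1 ≤ x ^ 2 := one_le_pow₀ (hR1.le.trans hx)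
    nlinarith
  obtain ⟨ε₁, hε₁, hnear⟩ := hav.exists_nhds hQ.le R
  -- choose the index `j` after which the exponents are replaced
  obtain ⟨j, hj1, hj2⟩ : ∃ j, 2 * (‖(d : ℂ)‖ * ((w ^ n j)⁻¹ * H)) < min ε ε₁ ∧
      ‖(((β - 1) * d : GaussianInt) : ℂ)‖ * R ≤ w ^ n j := by
    have ht : Tendsto (fun j => w ^ n j) atTop atTop :=
      (tendsto_pow_atTop_atTop_of_one_lt hβ).comp hmono.tendsto_atTop
    have ht' : Tendsto (fun j => 2 * (‖(d : ℂ)‖ * ((w ^ n j)⁻¹ * H))) atTop (𝓝 0) := by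
      simpa using (((ht.inv_tendsto_atTop).mul_const H).const_mul ‖(d : ℂ)‖).const_mul 2
    exact ((ht'.eventually_lt_const (lt_min hε hε₁)).and (ht.eventually_ge_atTop _)).exists
  obtain ⟨P, D, hD0, hPD, hDle, hDmin⟩ := exists_min_denominator (a := a) (d := d) (n := n) hβ j
  set r := foldPartial β a d n j with hr
  have hg0 : 0 < ‖(((β - 1) * d : GaussianInt) : ℂ)‖ := by
    rw [map_mul, map_sub, map_one, norm_mul]; positivity
  have hlarge : ∀ q : GaussianInt, q ≠ 0 → β ^ n j ∣ q * ((β - 1) * d) →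
      w ^ n j ≤ ‖(q : ℂ)‖ * ‖(((β - 1) * d : GaussianInt) : ℂ)‖ := by
    rintro q hq ⟨t, ht⟩
    have ht0 : t ≠ 0 := by
      rintro rfl
      rw [mul_zero, ← GaussianInt.toComplex_eq_zero, map_mul, mul_eq_zero,
        GaussianInt.toComplex_eq_zero, ← norm_eq_zero] at ht
      exact ht.elim hq hg0.ne'
    have h1 := GaussianInt.one_le_norm_toComplex ht0
    rw [← norm_mul, ← map_mul, ht, map_mul, map_pow, norm_mul, norm_pow]
    exact le_mul_of_one_le_right (hwp _).le h1
  have hlargeR : ∀ q : GaussianInt, q ≠ 0 → β ^ n j ∣ q * ((β - 1) * d) → R ≤ ‖(q : ℂ)‖ :=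
    fun q hq hdvd => by
      have := hj2.trans (hlarge q hq hdvd)
      rw [mul_comm] at this
      exact le_of_mul_le_mul_right this hg0
  have hDR : R ≤ ‖(D : ℂ)‖ := hlargeR D hD0 (dvd_of_foldPartial_eq hβ hmono hD0 hPD)
  have hD1 : 1 < ‖(D : ℂ)‖ := hR1.trans_le hDR
  -- the first jump for which the partial sum approximates too well
  have hex : ∃ m, K * H * (w ^ m)⁻¹ ≤ c * (‖(D : ℂ)‖ ^ 2 * Ψ ‖(D : ℂ)‖) := by
    have ht : Tendsto (fun m : ℕ => K * H * (w ^ m)⁻¹) atTop (𝓝 0) := by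
      simpa using ((tendsto_pow_atTop_atTop_of_one_lt hβ).inv_tendsto_atTop).const_mul (K * H)
    exact (ht.eventually_le_const (mul_pos hc0 (hφpos _ hD1))).exists
  classical
  set M := Nat.find hex with hM
  have hM1 := Nat.find_spec hex
  have hM2 : ∀ m < M, c * (‖(D : ℂ)‖ ^ 2 * Ψ ‖(D : ℂ)‖) < K * H * (w ^ m)⁻¹ := fun m hm =>
    not_le.1 (Nat.find_min hex hm)
  let n' : ℕ → ℕ → ℕ := fun m => refold n j m (2 * n j + M)
  let z : ℕ → ℂ := fun m => foldPoint β a d (n' m)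
  have hn0 : ∀ m, n' m 0 = 8 := fun m => by simp only [n']; rw [refold_of_le (Nat.zero_le _), h0]
  have hn2 : ∀ m ≤ M, ∀ k, 2 * n' m k ≤ n' m (k + 1) := fun m hm => two_mul_refold_le h2 hm
  have hnmono : ∀ m ≤ M, StrictMono (n' m) := fun m hm => strictMono_of_two_mul_le (hn0 m) (hn2 m hm)
  have hnB : ∀ m ≤ M, M - m ≤ B → ∀ k, k ≠ j → n' m (k + 1) ≤ 2 * n' m k + B :=
    fun m hm hMm => refold_succ_le hB hm hMm
  have hnB' : ∀ m ≤ M, M - m ≤ B → ∀ k, n' m (k + 1) ≤ 2 * n' m k + max B m := by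
    intro m hm hMm k
    by_cases hk : k = j
    · subst hk
      simp only [n']
      rw [refold_of_le le_rfl, refold_succ_self]
      have := le_max_right B m
      omega
    · have := hnB m hm hMm k hk
      have := le_max_left B m
      omega
  have hzr : ∀ m ≤ M, ‖z m - r‖ ≤ ‖(d : ℂ)‖ * ((w ^ (2 * n j + m))⁻¹ * H) := by
    intro m hm
    have h := norm_foldPoint_sub_partial_le (a := a) (d := d) hβ (hnmono m hm) j
    rw [foldPartial_congr hβ0 hmono.monotone (hnmono m hm).monotone fun k hk => refold_of_le hk] at h
    simp only [n'] at h
    rwa [refold_succ_self] at h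
  have hζr : ‖foldPoint β a d n - r‖ ≤ ‖(d : ℂ)‖ * ((w ^ n j)⁻¹ * H) := by
    refine (norm_foldPoint_sub_partial_le hβ hmono j).trans ?_
    gcongr
    · exact hβ.le
    · exact hmono.monotone (Nat.le_succ j)
  have hzζ : ∀ m ≤ M, ‖z m - foldPoint β a d n‖ < min ε ε₁ := by
    intro m hm
    refine lt_of_le_of_lt ?_ hj1
    have h1 : ‖z m - r‖ ≤ ‖(d : ℂ)‖ * ((w ^ n j)⁻¹ * H) := by
      refine (hzr m hm).trans ?_
      gcongr
      · exact hβ.le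
      · omega
    have := norm_sub_le (z m - r) (foldPoint β a d n - r)
    rw [sub_sub_sub_cancel_right] at this
    linarith
  -- fractions are either avoided, or their denominators are nearly divisible by `β ^ n j`
  have hdich : ∀ m ≤ M, M - m ≤ B → ∀ p q : GaussianInt, Q ≤ ‖(q : ℂ)‖ →
      c * Ψ ‖(q : ℂ)‖ < ‖z m - (p : ℂ) / q‖ ∨
      (β ^ n j ∣ q * ((β - 1) * d) ∧ ‖(D : ℂ)‖ ≤ ‖(q : ℂ)‖ ∧
        κ (max B m) ≤ ‖(q : ℂ)‖ ^ 2 * ‖z m - (p : ℂ) / q‖) := by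
    intro m hm hMm p q hq
    have hq1 : 1 < ‖(q : ℂ)‖ := hQ.trans_le hq
    have hq0 : q ≠ 0 := by rintro rfl; simp at hq1; linarith
    rcases lt_or_ge ‖(q : ℂ)‖ R with hqR | hqR
    · exact Or.inl (hnear _ ((hzζ m hm).trans_le (min_le_right _ _)) p q hq hqR.le)
    have hsmall : κ B ≤ ‖(q : ℂ)‖ ^ 2 * ‖z m - (p : ℂ) / q‖ →
        c * Ψ ‖(q : ℂ)‖ < ‖z m - (p : ℂ) / q‖ := fun h => by
      refine lt_of_sq_mul_lt (by linarith) (lt_of_lt_of_le ?_ h)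
      have h3 := hφκ _ hqR
      have h4 := hφpos _ hq1
      nlinarith
    by_cases hdvd : β ^ n j ∣ q * ((β - 1) * d)
    swap
    · refine Or.inl (hsmall ?_)
      refine foldPoint_lower_bound hβ hd (hn0 m) (hn2 m hm) (fun k => ?_) hq0 hdvd
      by_cases hk : k = j
      · right; subst hk; simp only [n']; rw [refold_of_le le_rfl]
      · exact Or.inl (hnB m hm hMm k hk)
    have hall : κ (max B m) ≤ ‖(q : ℂ)‖ ^ 2 * ‖z m - (p : ℂ) / q‖ :=
      foldPoint_lower_bound_all hβ hd (hn0 m) (hn2 m hm) (hnB' m hm hMm) hq0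
    rcases le_or_gt ‖(D : ℂ)‖ ‖(q : ℂ)‖ with hDq | hDq
    · exact Or.inr ⟨hdvd, hDq, hall⟩
    refine Or.inl (hsmall ?_)
    rcases le_or_gt m B with hmB | hmB
    · rwa [max_eq_left hmB] at hall
    -- `D` is the least denominator of `r`, so `p / q` is not `r` and is far from it
    have hne : r ≠ (p : ℂ) / q := fun he => absurd (hDmin p q hq0 he) (not_le.2 hDq)
    refine le_trans ?_ (lower_bound_of_norm_lt hq0 hD0 hPD hne)
    have hg := hlarge q hq0 hdvd
    rw [map_mul, map_sub, map_one, norm_mul] at hg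
    have hDpos : 0 < ‖(D : ℂ)‖ := by linarith
    have e1 : 1 / K ≤ ‖(q : ℂ)‖ / ‖(D : ℂ)‖ := by
      rw [div_le_div_iff₀ hK0 hDpos, one_mul, hK]
      calc ‖(D : ℂ)‖ ≤ ‖(β : ℂ) - 1‖ * w ^ n j := hDle
        _ ≤ ‖(β : ℂ) - 1‖ * (‖(q : ℂ)‖ * (‖(β : ℂ) - 1‖ * ‖(d : ℂ)‖)) := by gcongr
        _ = _ := by ring
    have e2 : ‖(q : ℂ)‖ ^ 2 * ‖z m - r‖ ≤ K * H * (w ^ m)⁻¹ := by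
      calc ‖(q : ℂ)‖ ^ 2 * ‖z m - r‖ ≤ (‖(β : ℂ) - 1‖ * w ^ n j) ^ 2 *
            (‖(d : ℂ)‖ * ((w ^ (2 * n j + m))⁻¹ * H)) := by
            gcongr
            · exact hDq.le.trans hDle
            · exact hzr m hm
        _ = K * H * (w ^ m)⁻¹ := by
            rw [hK, pow_add, pow_mul', mul_pow]; field_simp
    have e3 : 64 * w ^ 8 * K ^ 2 * H ≤ w ^ m :=
      hC.le.trans (pow_le_pow_right₀ hβ.le (by omega))
    have hw8 : 1 ≤ w ^ 8 := one_le_pow₀ hβ.le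
    have e4 : K * H * (w ^ m)⁻¹ ≤ 1 / (2 * K) := by
      rw [← div_eq_mul_inv, div_le_div_iff₀ (hwp m) (by positivity)]
      have e7 : 2 * (K ^ 2 * H) ≤ 64 * w ^ 8 * (K ^ 2 * H) := by gcongr; linarith
      linarith
    have e5 : κ B ≤ 1 / (2 * K) := by
      simp only [κ]
      rw [one_div]
      apply inv_anti₀ (by positivity)
      have : 1 ≤ w ^ (8 + B) := one_le_pow₀ hβ.le
      gcongr
      linarith
    have e6 : 1 / (2 * K) + 1 / (2 * K) = 1 / K := by field_simp; norm_num
    linarith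
  -- the stage survives at the lower end of the window, but not at the upper end
  have hlo : StrictlyAvoids (fun x => c * Ψ x) Q (z (M - (C + 1))) := by
    intro p q hq
    rcases hdich (M - (C + 1)) (Nat.sub_le _ _) (by omega) p q hq with h | ⟨hdvd, hDq, hall⟩
    · exact h
    have hq1 : 1 < ‖(q : ℂ)‖ := hQ.trans_le hq
    refine lt_of_sq_mul_lt (by linarith) (lt_of_lt_of_le ?_ hall)
    have h4 := hφpos _ hq1
    rcases le_or_gt (M - (C + 1)) B with hmB | hmB
    · rw [max_eq_left hmB]
      have h3 := hφκ _ (hDR.trans hDq)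
      simp only
      nlinarith
    · rw [max_eq_right hmB.le]
      have h5 : ‖(q : ℂ)‖ ^ 2 * Ψ ‖(q : ℂ)‖ ≤ ‖(D : ℂ)‖ ^ 2 * Ψ ‖(D : ℂ)‖ := hanti hD1 hq1 hDq
      have h6 := hM2 (M - 1) (by omega)
      have h7 : K * H * (w ^ (M - 1))⁻¹ ≤ κ (M - (C + 1)) := by
        obtain ⟨e, he⟩ : ∃ e, M = e + (C + 1) := ⟨M - (C + 1), by omega⟩
        rw [he]
        simp only [κ, Nat.add_sub_cancel]
        rw [← div_eq_mul_inv, div_le_iff₀ (hwp _), inv_mul_eq_div, le_div_iff₀ (by positivity),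
          show e + (C + 1) - 1 = e + C by omega, pow_add, pow_add]
        calc K * H * (64 * (w ^ 8 * w ^ e) * K) = w ^ e * (64 * w ^ 8 * K ^ 2 * H) := by ring
          _ ≤ w ^ e * w ^ C := by gcongr
      simp only
      nlinarith
  have hhi : ¬ StrictlyAvoids (fun x => c * Ψ x) Q (z M) := by
    intro h
    have h1 := h P D ((le_max_right _ _).trans hDR)
    rw [← hPD] at h1
    have h3 : ‖(D : ℂ)‖ ^ 2 * ‖z M - r‖ ≤ K * H * (w ^ M)⁻¹ := by
      calc ‖(D : ℂ)‖ ^ 2 * ‖z M - r‖ ≤ (‖(β : ℂ) - 1‖ * w ^ n j) ^ 2 *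
            (‖(d : ℂ)‖ * ((w ^ (2 * n j + M))⁻¹ * H)) := by
            gcongr
            exact hzr M le_rfl
        _ = K * H * (w ^ M)⁻¹ := by
            rw [hK, pow_add, pow_mul', mul_pow]; field_simp
    have h4 : 0 < ‖(D : ℂ)‖ ^ 2 := by positivity
    have h5 := mul_lt_mul_of_pos_left h1 h4
    simp only at h5
    linarith
  obtain ⟨m, hm1, hm2, hm3, hm4⟩ : ∃ m, M - (C + 1) ≤ m ∧ m < M ∧
      StrictlyAvoids (fun x => c * Ψ x) Q (z m) ∧
      ¬ StrictlyAvoids (fun x => c * Ψ x) Q (z (m + 1)) := by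
    by_contra! hcon
    refine hhi (Nat.le_induction (m := M - (C + 1)) (P := fun m _ => m ≤ M →
      StrictlyAvoids (fun x => c * Ψ x) Q (z m)) (fun _ => hlo) ?_ M (Nat.sub_le _ _) le_rfl)
    intro m hm ih hmM
    exact hcon m hm (by omega) (ih (by omega))
  -- the fraction that breaks stage `m + 1`, moved along with `z`, keeps its denominator
  unfold StrictlyAvoids at hm4
  push Not at hm4
  obtain ⟨p, q, hq, hpq⟩ := hm4
  have hq1 : 1 < ‖(q : ℂ)‖ := hQ.trans_le hq
  have hq0 : q ≠ 0 := by rintro rfl; simp at hq1; linarith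
  have hqc : (q : ℂ) ≠ 0 := by rwa [Ne, GaussianInt.toComplex_eq_zero]
  obtain ⟨⟨t, ht⟩, hDq, -⟩ := (hdich (m + 1) hm2 (by omega) p q hq).resolve_left (not_lt.2 hpq)
  have hpr : z m - ((β * p - (q * a + foldNum β n j * t) : GaussianInt) : ℂ) / q =
      β * (z (m + 1) - (p : ℂ) / q) := by
    have h1 := foldPoint_refold_succ (a := a) (d := d) (j := j) hβ h0 h2 hm2
    have h3 := sub_one_mul_foldPartial (a := a) hβ ht
    rw [map_sub, ← h3, map_mul]
    simp only [z, n', ← hr] at h1 ⊢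
    field_simp
    linear_combination (q : ℂ) * h1
  have hwit : ‖z m - ((β * p - (q * a + foldNum β n j * t) : GaussianInt) : ℂ) / q‖ <
      Ψ ‖(q : ℂ)‖ := by
    rw [hpr, norm_mul]
    have := hpos _ hq1
    calc w * ‖z (m + 1) - (p : ℂ) / q‖ ≤ w * (c * Ψ ‖(q : ℂ)‖) := by gcongr
      _ = c * w * Ψ ‖(q : ℂ)‖ := by ring
      _ < 1 * Ψ ‖(q : ℂ)‖ := by gcongr
      _ = _ := one_mul _
  have hRq := hDR.trans hDq
  refine ⟨z m, ⟨n' m, max B m, hn0 m, hn2 m hm2.le, hnB' m hm2.le (by omega), rfl, hm3⟩,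
    (hzζ m hm2.le).trans_le (min_le_left _ _), fun heq => ?_, _, q, hq, hwit,
    hwit.trans (hΨε _ hRq)⟩
  rw [heq] at hwit
  have h1 : κ B ≤ _ := foldPoint_lower_bound_all (a := a) (d := d)
    (p := β * p - (q * a + foldNum β n j * t)) hβ hd h0 h2 hB hq0
  have h3 := hφκ _ hRq
  have h4 : 0 < ‖(q : ℂ)‖ ^ 2 := by positivity
  have h5 := mul_lt_mul_of_pos_left hwit h4
  linarith

end Step

/-! ### The digit set and the category argument -/

theorem foldPoint_mem_digitSet {β : GaussianInt} {n : ℕ → ℕ} (hβ : 1 < ‖(β : ℂ)‖)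
    (h : StrictMono n) (h0 : n 0 = 8) {J : Set ℕ} {x y : ℕ} (hx : x ∈ J) (hy : y ∈ J) :
    foldPoint β x (y - x) n ∈ digitSet β J := by
  classical
  have hβ0 : β ≠ 0 := ne_zero_of_one_lt_norm hβ
  have hb : (β : ℂ) ≠ 0 := by rwa [Ne, GaussianInt.toComplex_eq_zero]
  have hb1 : (β : ℂ) - 1 ≠ 0 := sub_one_ne_zero_of_one_lt_norm hβ
  have hpos : ∀ k, n k - 1 + 1 = n k := fun k => by
    have := h.monotone (Nat.zero_le k)
    omega
  refine ⟨fun j => if j + 1 ∈ Set.range n then y else x, fun j => by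
    simp only; split_ifs <;> assumption, ?_⟩
  have h1 : HasSum (fun j : ℕ => (x : ℂ) * ((β : ℂ) ^ (j + 1))⁻¹) ((x : ℂ) / ((β : ℂ) - 1)) := by
    have hs := (hasSum_geometric_of_norm_lt_one (ξ := (β : ℂ)⁻¹)
      (by rw [norm_inv]; exact inv_lt_one_of_one_lt₀ hβ)).mul_left ((x : ℂ) * (β : ℂ)⁻¹)
    have e1 : (fun j : ℕ => (x : ℂ) * ((β : ℂ) ^ (j + 1))⁻¹) =
        fun j : ℕ => (x : ℂ) * (β : ℂ)⁻¹ * (β : ℂ)⁻¹ ^ j := by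
      funext j; rw [pow_succ, mul_inv, inv_pow]; ring
    have e2 : (x : ℂ) / ((β : ℂ) - 1) = (x : ℂ) * (β : ℂ)⁻¹ * (1 - (β : ℂ)⁻¹)⁻¹ := by
      have : 1 - (β : ℂ)⁻¹ ≠ 0 := by
        rw [sub_ne_zero]; intro he; apply hb1
        rw [← inv_inv (β : ℂ), ← he]; simp
      field_simp
    rw [e1, e2]
    exact hs
  have h2 : HasSum (fun j : ℕ => if j + 1 ∈ Set.range n then
      ((y : ℂ) - x) * ((β : ℂ) ^ (j + 1))⁻¹ else 0) (((y : ℂ) - x) * foldSum β n) := by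
    have hinj : Function.Injective fun k => n k - 1 := fun k l hkl => by
      have e1 := hpos k
      have e2 := hpos l
      simp only at hkl
      exact h.injective (by omega)
    rw [← hinj.hasSum_iff]
    · have e : ((fun j : ℕ => if j + 1 ∈ Set.range n then
          ((y : ℂ) - x) * ((β : ℂ) ^ (j + 1))⁻¹ else 0) ∘ fun k => n k - 1) =
          fun k => ((y : ℂ) - x) * ((β : ℂ) ^ n k)⁻¹ := by
        funext k
        simp only [Function.comp_apply, hpos]
        exact if_pos ⟨k, rfl⟩
      rw [e]
      exact (summable_foldSum hβ h).hasSum.mul_left ((y : ℂ) - x)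
    · intro j hj
      refine if_neg fun hmem => hj ?_
      obtain ⟨k, hk⟩ := hmem
      exact ⟨k, by simp only; omega⟩
  have h3 := h1.add h2
  rw [foldPoint, map_sub, map_natCast, map_natCast]
  refine h3.congr_fun fun j => ?_
  by_cases hj : j + 1 ∈ Set.range n
  · simp only [if_pos hj]; ring
  · simp only [if_neg hj]; ring

/-- The digit set is a continuous image of the compact space `ℕ → J`. -/
theorem isClosed_digitSet {b : ℂ} (hb : 1 < ‖b‖) {J : Set ℕ} (hJ : J.Finite) :
    IsClosed (digitSet b J) := by
  have : Finite J := hJ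
  obtain ⟨T, hT⟩ := hJ.bddAbove
  have hs : Summable fun j : ℕ => (T : ℝ) * (‖b‖⁻¹ ^ (j + 1)) :=
    ((summable_nat_add_iff 1).2
      (summable_geometric_of_lt_one (by positivity) (inv_lt_one_of_one_lt₀ hb))).mul_left _
  have hbound : ∀ (j : ℕ) (d : ℕ → J), ‖((d j : ℕ) : ℂ) * (b ^ (j + 1))⁻¹‖ ≤
      (T : ℝ) * (‖b‖⁻¹ ^ (j + 1)) := by
    intro j d
    rw [norm_mul, norm_inv, norm_pow, inv_pow, Complex.norm_natCast]
    gcongr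
    exact hT (d j).2
  have hcont : Continuous fun d : ℕ → J => ∑' j : ℕ, ((d j : ℕ) : ℂ) * (b ^ (j + 1))⁻¹ := by
    refine continuous_tsum (fun j => ?_) hs hbound
    exact ((continuous_of_discreteTopology (f := fun t : J => ((t : ℕ) : ℂ))).comp
      (continuous_apply j)).mul continuous_const
  have hrange : digitSet b J =
      Set.range fun d : ℕ → J => ∑' j : ℕ, ((d j : ℕ) : ℂ) * (b ^ (j + 1))⁻¹ := by
    ext ζ
    constructor
    · rintro ⟨d, hd, hsum⟩
      exact ⟨fun j => ⟨d j, hd j⟩, hsum.tsum_eq⟩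
    · rintro ⟨d, rfl⟩
      exact ⟨fun j => d j, fun j => (d j).2,
        (Summable.of_norm_bounded hs fun j => hbound j d).hasSum⟩
  rw [hrange]
  exact (isCompact_range hcont).isClosed

/-- Baire category on the closure of `S`, for conditions that are open and densely satisfied
in `S`. -/
theorem exists_mem_closure_forall_mem {S : Set ℂ} (hS : S.Nonempty) {U : ℕ → Set ℂ}
    (hU : ∀ i, IsOpen (U i))
    (hd : ∀ i, ∀ ζ ∈ S, ∀ ε > 0, ∃ ζ' ∈ S, ‖ζ' - ζ‖ < ε ∧ ζ' ∈ U i) :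
    ∃ ζ ∈ closure S, ∀ i, ζ ∈ U i := by
  have : CompleteSpace (closure S) := isClosed_closure.completeSpace_coe
  obtain ⟨ζ₀, hζ₀⟩ := hS
  have : Nonempty (closure S) := ⟨⟨ζ₀, subset_closure hζ₀⟩⟩
  have hdense : Dense (⋂ i, (Subtype.val ⁻¹' U i : Set (closure S))) := by
    refine dense_iInter_of_isOpen_nat (fun i => (hU i).preimage continuous_subtype_val) fun i => ?_
    rw [Metric.dense_iff]
    intro ζ ε hε
    obtain ⟨ζ₁, hζ₁, h1⟩ := Metric.mem_closure_iff.1 ζ.2 (ε / 2) (by positivity)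
    obtain ⟨ζ₂, hζ₂, h2, h3⟩ := hd i ζ₁ hζ₁ (ε / 2) (by positivity)
    refine ⟨⟨ζ₂, subset_closure hζ₂⟩, ?_, h3⟩
    rw [Metric.mem_ball, Subtype.dist_eq]
    rw [← dist_eq_norm] at h2
    rw [dist_comm] at h1
    calc dist ζ₂ (ζ : ℂ) ≤ dist ζ₂ ζ₁ + dist ζ₁ ζ := dist_triangle _ _ _
      _ < ε := by linarith
  obtain ⟨ζ, hζ⟩ := hdense.nonempty
  exact ⟨ζ, ζ.2, fun i => Set.mem_iInter.1 hζ i⟩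

theorem notMem_approximableSet {Ψ : ℝ → ℝ} {Q : ℝ} {ζ : ℂ}
    (h : ∀ p q : GaussianInt, Q ≤ ‖(q : ℂ)‖ → Ψ ‖(q : ℂ)‖ ≤ ‖ζ - (p : ℂ) / q‖) :
    ζ ∉ approximableSet Ψ := by
  have hq := GaussianInt.finite_norm_le Q
  obtain ⟨T, hT⟩ := (hq.image fun q : GaussianInt => Ψ ‖(q : ℂ)‖).bddAbove
  have hp := GaussianInt.finite_norm_le (Q * (‖ζ‖ + max T 0))
  intro hinf
  refine hinf (((hp.prod hq).image fun x : GaussianInt × GaussianInt => (x.1 : ℂ) / x.2).subset ?_)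
  rintro r ⟨p, q, hq0, rfl, hlt⟩
  have hqQ : ‖(q : ℂ)‖ ≤ Q := by
    by_contra hcon
    exact absurd (h p q (not_le.1 hcon).le) (not_le.2 hlt)
  refine ⟨(p, q), ⟨?_, hqQ⟩, rfl⟩
  by_contra hcon
  have h1 := lt_norm_sub_div_of_large (GaussianInt.one_le_norm_toComplex hq0) hqQ
    (not_le.1 hcon) (le_max_right T 0)
  have h2 : Ψ ‖(q : ℂ)‖ ≤ max T 0 := (hT ⟨q, hqQ, rfl⟩).trans (le_max_left _ _)
  linarith

/-- Approximations of arbitrarily small but non-zero distance are infinitely many as numbers. -/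
theorem mem_approximableSet {Ψ : ℝ → ℝ} {ζ : ℂ}
    (h : ∀ ε > 0, ∃ p q : GaussianInt, q ≠ 0 ∧ ‖ζ - (p : ℂ) / q‖ < Ψ ‖(q : ℂ)‖ ∧
      ‖ζ - (p : ℂ) / q‖ < ε ∧ ζ ≠ (p : ℂ) / q) :
    ζ ∈ approximableSet Ψ := by
  intro hfin
  have hopen := (hfin.sdiff (t := {ζ})).isClosed.isOpen_compl
  obtain ⟨ε, hε, hball⟩ := Metric.isOpen_iff.1 hopen ζ (by simp)
  obtain ⟨p, q, hq, h1, h2, h3⟩ := h ε hε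
  refine hball (a := (p : ℂ) / q) ?_ ⟨⟨p, q, hq, rfl, h1⟩, fun he => h3 ?_⟩
  · rw [Metric.mem_ball, dist_comm, dist_eq_norm]; exact h2
  · exact (Set.mem_singleton_iff.1 he).symm

/-- For any sequence `s` there is a point of exact order in the digit set outside `s`. -/
theorem exists_mem_ne_seq {β : GaussianInt} (hβ : 1 < ‖(β : ℂ)‖) {J : Set ℕ} (hJ : J.Finite)
    (hJ2 : J.Nontrivial) {Ψ : ℝ → ℝ} (hpos : ∀ x : ℝ, 1 < x → 0 < Ψ x)
    (hanti : AntitoneOn (fun x : ℝ => x ^ 2 * Ψ x) (Set.Ioi 1))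
    (hlim : Tendsto (fun x : ℝ => x ^ 2 * Ψ x) atTop (𝓝 0)) {c : ℝ} (hc0 : 0 < c)
    (hc : c * ‖(β : ℂ)‖ < 1) (s : ℕ → ℂ) :
    ∃ ζ ∈ (approximableSet Ψ \ approximableSet (fun x => c * Ψ x)) ∩ digitSet β J,
      ∀ i, ζ ≠ s i := by
  obtain ⟨x, hx, y, hy, hxy⟩ := hJ2
  have hd : ((y : GaussianInt) - x) ≠ 0 := by
    rw [sub_ne_zero]; exact_mod_cast hxy.symm
  obtain ⟨Q, hQ, ζ₀, hζ₀⟩ := exists_isStage (a := (x : GaussianInt)) hβ hd hlim hc0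
    (show c < 1 by nlinarith)
  let U : ℕ → Set ℂ := fun i => {ζ | ∃ p q : GaussianInt, Q ≤ ‖(q : ℂ)‖ ∧
    ‖ζ - (p : ℂ) / q‖ < Ψ ‖(q : ℂ)‖ ∧ ‖ζ - (p : ℂ) / q‖ < 1 / ((i : ℝ) + 1)} ∩ {s i}ᶜ
  have hU : ∀ i, IsOpen (U i) := by
    intro i
    refine IsOpen.inter ?_ isClosed_singleton.isOpen_compl
    simp only [Set.ofPred_exists]
    refine isOpen_iUnion fun p => isOpen_iUnion fun q => ?_
    exact isOpen_const.and ((isOpen_lt (by fun_prop) continuous_const).and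
      (isOpen_lt (by fun_prop) continuous_const))
  obtain ⟨ζ, hζ, hζU⟩ := exists_mem_closure_forall_mem
    (S := {ζ | IsStage β x (y - x) Ψ c Q ζ}) ⟨ζ₀, hζ₀⟩ hU (by
      intro i ζ hζ ε hε
      have hi : (0 : ℝ) < 1 / ((i : ℝ) + 1) := by positivity
      by_cases hs : ζ = s i
      · obtain ⟨ζ', h1, h2, h3, p, q, hq, h4, h5⟩ :=
          IsStage.exists_next hβ hd hpos hanti hlim hc0 hc hQ hζ (lt_min hε hi)
        exact ⟨ζ', h1, h2.trans_le (min_le_left _ _),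
          ⟨p, q, hq, h4, h5.trans_le (min_le_right _ _)⟩, by rw [← hs]; exact h3⟩
      · have hs' : 0 < ‖s i - ζ‖ := norm_pos_iff.2 (sub_ne_zero.2 (Ne.symm hs))
        obtain ⟨ζ', h1, h2, -, p, q, hq, h4, h5⟩ :=
          IsStage.exists_next hβ hd hpos hanti hlim hc0 hc hQ hζ (lt_min (lt_min hε hs') hi)
        refine ⟨ζ', h1, h2.trans_le ((min_le_left _ _).trans (min_le_left _ _)),
          ⟨p, q, hq, h4, h5.trans_le (min_le_right _ _)⟩, fun he => ?_⟩
        have h6 := h2.trans_le ((min_le_left _ _).trans (min_le_right _ _))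
        rw [Set.mem_singleton_iff.1 he] at h6
        exact lt_irrefl _ h6)
  have havoid : ∀ p q : GaussianInt, Q ≤ ‖(q : ℂ)‖ → c * Ψ ‖(q : ℂ)‖ ≤ ‖ζ - (p : ℂ) / q‖ := by
    intro p q hq
    have hcl : IsClosed {ζ : ℂ | c * Ψ ‖(q : ℂ)‖ ≤ ‖ζ - (p : ℂ) / q‖} :=
      isClosed_le continuous_const (by fun_prop)
    refine closure_minimal ?_ hcl hζ
    rintro z ⟨n, B, -, -, -, -, hz⟩
    exact (hz p q hq).le
  refine ⟨ζ, ⟨⟨mem_approximableSet fun ε hε => ?_, notMem_approximableSet havoid⟩, ?_⟩,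
    fun i => (hζU i).2⟩
  · obtain ⟨i, hi⟩ := exists_nat_one_div_lt hε
    obtain ⟨⟨p, q, hq, h1, h2⟩, -⟩ := hζU i
    have hq1 : 1 < ‖(q : ℂ)‖ := hQ.trans_le hq
    refine ⟨p, q, ?_, h1, h2.trans hi, fun he => ?_⟩
    · rintro rfl; simp at hq1; linarith
    · have h3 := havoid p q hq
      rw [he, sub_self, norm_zero] at h3
      have := mul_pos hc0 (hpos _ hq1)
      linarith
  · refine closure_minimal ?_ (isClosed_digitSet hβ hJ) hζ
    rintro z ⟨n, B, h0, h2, -, rfl, -⟩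
    exact foldPoint_mem_digitSet hβ (strictMono_of_two_mul_le h0 h2) h0 hx hy

theorem theorem1 (A : ℕ) (hA : 1 ≤ A) (b : ℂ)
    (hb : b = -(A : ℂ) + Complex.I ∨ b = -(A : ℂ) - Complex.I)
    (J : Set ℕ) (hJ : J ⊆ Set.Icc 0 (A ^ 2)) (hJ2 : J.Nontrivial)
    (Ψ : ℝ → ℝ) (hpos : ∀ x : ℝ, 1 < x → 0 < Ψ x)
    (hanti : AntitoneOn (fun x : ℝ => x ^ 2 * Ψ x) (Set.Ioi 1))
    (hlim : Tendsto (fun x : ℝ => x ^ 2 * Ψ x) atTop (𝓝 0))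
    (c : ℝ) (hc : c ∈ Set.Ioo (0 : ℝ) ‖b‖⁻¹) :
    ((approximableSet Ψ \ approximableSet (fun x => c * Ψ x)) ∩ digitSet b J).Nonempty ∧
      (2 ≤ A →
        ¬ ((approximableSet Ψ \ approximableSet (fun x => c * Ψ x)) ∩ digitSet b J).Countable) := by
  obtain ⟨β, rfl⟩ : ∃ β : GaussianInt, (β : ℂ) = b := by
    rcases hb with rfl | rfl
    · exact ⟨⟨-A, 1⟩, by simp [GaussianInt.toComplex_def']⟩
    · exact ⟨⟨-A, -1⟩, by simp [GaussianInt.toComplex_def', sub_eq_add_neg]⟩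
  have hβ : 1 < ‖(β : ℂ)‖ := by
    have hA' : (1 : ℝ) ≤ A := by exact_mod_cast hA
    have hsq : 1 < ‖(β : ℂ)‖ ^ 2 := by
      rw [← Complex.normSq_eq_norm_sq, Complex.normSq_apply]
      rcases hb with h | h <;> rw [h] <;> simp <;> nlinarith
    nlinarith [norm_nonneg (β : ℂ)]
  have hJf : J.Finite := (Set.finite_Icc 0 (A ^ 2)).subset hJ
  have hcβ : c * ‖(β : ℂ)‖ < 1 := by
    have h := mul_lt_mul_of_pos_right hc.2 (zero_lt_one.trans hβ)
    rwa [inv_mul_cancel₀ (by linarith)] at h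
  have key := exists_mem_ne_seq hβ hJf hJ2 hpos hanti hlim hc.1 hcβ
  obtain ⟨ζ, hζ, -⟩ := key fun _ => 0
  refine ⟨⟨ζ, hζ⟩, fun _ hcount => ?_⟩
  obtain ⟨s, hs⟩ := hcount.exists_eq_range ⟨ζ, hζ⟩
  obtain ⟨ζ', hζ', hne⟩ := key s
  rw [hs] at hζ'
  obtain ⟨i, hi⟩ := hζ'
  exact hne i hi.symm
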